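/- Let $p\ge 3$. For $n\ge 0$ let $\mathbb{F}_n^p$ be the poset of Dyck paths of semilength $n$ (steps $U=(1,1)$, $D=(1,-1)$) that avoid the consecutive patterns $DUU$ and $D^{p+1}$, ordered by $P\le Q$ if and only if the path $P$ lies weakly below the path $Q$. An interval $[P,Q]=\{R\in\mathbb{F}_n^p : P\le R\le Q\}$ (with $P\le Q$) is called linear if its elements are pairwise comparable, and its height is the length of a longest chain in it. Let $F_p(x)=\sum_{n\ge 0}|\mathbb{F}_n^p|\,x^n$, let $L_p(x,y)$ be the formal power series in which the coefficient of $x^ny^k$ is the number of linear intervals of height $k$ in $\mathbb{F}_n^p$, and put $G_p(x)=1-x-x^2-\cdots-x^p$. Theorem. One has $F_p(x)=\dfrac{1}{G_p(x)}$ and, as formal power series, $$L_p(x,y)=F_p(x)\cdot\left(1+\frac{x^3y^3(1-x^{p-2})}{1-x}+V_p(x,y)+W_p(x,y)\right),$$ where $$V_p(x,y)=\sum_{\substack{1\le i,j\le p\\ j-i\ge 2}}x^jy^{j-i}\left(1+\frac{x+x^2+\cdots+x^{p-(j-i)}}{G_p(x)}\right),$$ $$W_p(x,y)=\frac{y(1-x^p)(x^2-x^{p+1})(1-x^{p+1}y^2)}{(1-x)(1-xy)(1-x^py)\,G_p(x)}.$$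 -/

import Mathlib

open MvPowerSeries

/-- The ordinate reached by the Dyck path `P` after `k` steps (`0` when `k` exceeds its length). -/
def pathOrdinate (P : DyckWord) (k : ℕ) : ℤ :=
  ((P.toList.take k).count DyckStep.U : ℤ) - ((P.toList.take k).count DyckStep.D : ℤ)

/-- The set `𝓕_n^p`: Dyck paths of semilength `n` that avoid the patterns (consecutive factors)
`DUU` and `D^{p+1}`. -/
@[ext]
structure FibPath (p n : ℕ) where
  path : DyckWord
  semilength_eq : path.semilength = n
  avoids_DUU : ¬ [DyckStep.D, DyckStep.U, DyckStep.U] <:+: path.toList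
  avoids_D : ¬ List.replicate (p + 1) DyckStep.D <:+: path.toList

theorem list_eq_of_ordinate_eq : ∀ (l₁ l₂ : List DyckStep), l₁.length = l₂.length →
    (∀ k, ((l₁.take k).count DyckStep.U : ℤ) - ((l₁.take k).count DyckStep.D : ℤ) =
      ((l₂.take k).count DyckStep.U : ℤ) - ((l₂.take k).count DyckStep.D : ℤ)) → l₁ = l₂
  | [], [], _, _ => rfl
  | [], _ :: _, h, _ => by simp at h
  | _ :: _, [], h, _ => by simp at h
  | a :: l₁, b :: l₂, h, hk => by
    have hab : a = b := by
      have h1 := hk 1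
      cases a <;> cases b <;> simp at h1 ⊢
    subst hab
    congr 1
    refine list_eq_of_ordinate_eq l₁ l₂ (by simpa using h) fun k => ?_
    have h1 := hk (k + 1)
    simp only [List.take_succ_cons, List.count_cons] at h1
    push_cast at h1
    linarith

theorem dyckWord_eq_of_ordinate_eq {P Q : DyckWord} (h : P.semilength = Q.semilength)
    (hk : ∀ k, pathOrdinate P k = pathOrdinate Q k) : P = Q := by
  apply DyckWord.ext
  apply list_eq_of_ordinate_eq _ _ _ hk
  rw [← P.two_mul_semilength_eq_length, ← Q.two_mul_semilength_eq_length, h]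

/-- The poset `𝔽_n^p`: the set `𝓕_n^p` with the Stanley order, in which `P ≤ Q` when the path `P`
lies weakly below the path `Q`. -/
instance FibPath.instPartialOrder (p n : ℕ) : PartialOrder (FibPath p n) where
  le P Q := ∀ k, pathOrdinate P.path k ≤ pathOrdinate Q.path k
  le_refl _ _ := le_rfl
  le_trans _ _ _ h₁ h₂ k := (h₁ k).trans (h₂ k)
  le_antisymm P Q h₁ h₂ := FibPath.ext (dyckWord_eq_of_ordinate_eq
    (P.semilength_eq.trans Q.semilength_eq.symm) fun k => le_antisymm (h₁ k) (h₂ k))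

instance FibPath.instFinite (p n : ℕ) : Finite (FibPath p n) :=
  Finite.of_injective
    (fun P : FibPath p n => (⟨P.path, P.semilength_eq⟩ : {w : DyckWord // w.semilength = n}))
    fun _ _ h => FibPath.ext (congrArg Subtype.val h)

instance FibPath.instFiniteInterval (p n : ℕ) : Finite (NonemptyInterval (FibPath p n)) :=
  Finite.of_injective _ NonemptyInterval.toProd_injective

/-- The interval `[P, Q]` is linear: its elements are pairwise comparable. -/
def IsLinearInterval {α : Type*} [PartialOrder α] (I : NonemptyInterval α) : Prop :=
  ∀ R ∈ Set.Icc I.fst I.snd, ∀ S ∈ Set.Icc I.fst I.snd, R ≤ S ∨ S ≤ R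

/-- The height of the interval `[P, Q]`: the largest length `k` of a chain `R₀ < R₁ < ⋯ < R_k`
of elements of `[P, Q]`. -/
noncomputable def intervalHeight {α : Type*} [PartialOrder α] (I : NonemptyInterval α) :
    WithBot ℕ∞ :=
  Order.krullDim (Set.Icc I.fst I.snd)

/-- The number of linear intervals of height `k` in `𝔽_n^p`. -/
noncomputable def linearIntervalCount (p n k : ℕ) : ℕ :=
  Nat.card {I : NonemptyInterval (FibPath p n) //
    IsLinearInterval I ∧ intervalHeight I = (k : WithBot ℕ∞)}

/-- Formal power series in the two variables `x` and `y`. -/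
abbrev BiSeries : Type := MvPowerSeries (Fin 2) ℚ

/-- The variable `x`. -/
noncomputable def xVar : BiSeries := X 0

/-- The variable `y`. -/
noncomputable def yVar : BiSeries := X 1

/-- `L_p(x, y)`: the coefficient of `x^n y^k` is the number of linear intervals of height `k`
in `𝔽_n^p`. -/
noncomputable def linearIntervalSeries (p : ℕ) : BiSeries :=
  fun m => (linearIntervalCount p (m 0) (m 1) : ℚ)

/-- `F_p(x)`: the coefficient of `x^n` is the number of elements of `𝔽_n^p`. -/
noncomputable def fibPathSeries (p : ℕ) : BiSeries :=
  fun m => if m 1 = 0 then (Nat.card (FibPath p (m 0)) : ℚ) else 0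

/-- `G_p(x) = 1 - x - x^2 - ⋯ - x^p`. -/
noncomputable def Gpoly (p : ℕ) : BiSeries :=
  1 - ∑ i ∈ Finset.Icc 1 p, xVar ^ i

/-- `V_p(x, y)`. -/
noncomputable def Vseries (p : ℕ) : BiSeries :=
  ∑ i ∈ Finset.Icc 1 p, ∑ j ∈ Finset.Icc 1 p with i + 2 ≤ j,
    xVar ^ j * yVar ^ (j - i) *
      (1 + (∑ k ∈ Finset.Icc 1 (p - (j - i)), xVar ^ k) * (Gpoly p)⁻¹)

/-- `W_p(x, y)`. -/
noncomputable def Wseries (p : ℕ) : BiSeries :=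
  yVar * (1 - xVar ^ p) * (xVar ^ 2 - xVar ^ (p + 1)) * (1 - xVar ^ (p + 1) * yVar ^ 2) *
    ((1 - xVar) * (1 - xVar * yVar) * (1 - xVar ^ p * yVar) * Gpoly p)⁻¹

/-! Encode a path by its gap sequence `s`, where `s i` counts the down steps after the `i`-th last
up step. Avoiding `D^{p+1}` bounds the increments of `s` by `p`, avoiding `DUU` makes `s` strictly
increasing until it reaches `n`, and the Stanley order becomes the pointwise order
(`nonempty_gapSeq_orderIso_fibPath`). Removing the first term, which lies in `1, …, p`, gives `F = 1
+ (x + ⋯ + x^p) F`.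

In `[P, Q]`, raising the `i`-th term to `v` has a least realization, `gapLift`. The interval is
linear exactly when these lifts are pairwise comparable, which is the numerical condition `Aligned`
(`aligned_of_linear`, `linear_of_aligned`). Between distinct comparable sequences a single term can
always be raised by one, so the height is the sum of the differences (`GapSeq.krullDim_Icc`).

Removing a common first term gives `L * G = 1 + A`, where `A` counts the linear intervals whose
bounds have distinct first terms. By `aligned_iff` such bounds differ at the first index only, or
differ by one along an initial staircase of step `p` or of step `1`, or form an exceptional pair of
height three. In the first three shapes `P` is `Q` lowered by `d` on an initial block, and the rest
of `Q` is free except that its next increment is at most `p - d` (`ncard_stairPair`). Single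
differences of at least two give `V`. The two staircase families are geometric series in `y`; their
height-one terms coincide, and counting that term once gives `W`. There is one exceptional pair for
each `3 ≤ n ≤ p`, whence the term `x^3 y^3 (1 - x^{p-2}) / (1 - x)`. -/

/-! ### Gap sequences and the numerical criterion for linearity. -/

/-- The sequences recording the number of down steps after the `i`-th last up step of a path
in `FibPath p n`. -/
structure IsGapSeq (p n : ℕ) (s : ℕ → ℕ) : Prop where
  zero : s 0 = 0
  le : ∀ i, s i ≤ n
  -- This is `DUU`-avoidance: a zero gap after the first forces all later gaps to vanish, so growth
  -- stops only at `n`. The case `i = 0` says that a nonempty path ends with a down step.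
  lower : ∀ i, min (s i + 1) n ≤ s (i + 1)
  upper : ∀ i, s (i + 1) ≤ s i + p

namespace IsGapSeq

variable {p n : ℕ} {s P Q R : ℕ → ℕ}

theorem lower_add (h : IsGapSeq p n s) (i j : ℕ) : min (s i + j) n ≤ s (i + j) := by
  induction j with
  | zero => simp
  | succ j ih => have := h.lower (i + j); rw [← add_assoc i j 1]; omega

theorem upper_add (h : IsGapSeq p n s) (i j : ℕ) : s (i + j) ≤ s i + p * j := by
  induction j with
  | zero => simp
  | succ j ih => have := h.upper (i + j); rw [← add_assoc i j 1, mul_add]; omega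

theorem le_succ (h : IsGapSeq p n s) (i : ℕ) : s i ≤ s (i + 1) := by
  have := h.lower i; have := h.le i; omega

theorem mono (h : IsGapSeq p n s) : Monotone s := monotone_nat_of_le_succ h.le_succ

theorem min_le (h : IsGapSeq p n s) (i : ℕ) : min i n ≤ s i := by
  have := h.lower_add 0 i; simpa [h.zero] using this

theorem le_mul (h : IsGapSeq p n s) (i : ℕ) : s i ≤ p * i := by
  have := h.upper_add 0 i; simpa [h.zero] using this

theorem eq_top (h : IsGapSeq p n s) {i : ℕ} (hi : n ≤ i) : s i = n := by
  have := h.min_le i; have := h.le i; omega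

end IsGapSeq

/-- The least sequence above `P` whose `i`-th term is at least `v`. -/
def gapLift (p n : ℕ) (P : ℕ → ℕ) (i v : ℕ) : ℕ → ℕ := fun j =>
  max (P j) (if i ≤ j then min (v + (j - i)) n else v - p * (i - j))

/-- The bound `v ≤ p * i` keeps the term of index `0` equal to `0`: descending from `v` by `p` per
index must reach `0` there. -/
theorem IsGapSeq.gapLift {p n : ℕ} {P : ℕ → ℕ} (hP : IsGapSeq p n P) (hp : 1 ≤ p) {i v : ℕ}
    (hv : v ≤ p * i) (hvn : v ≤ n) (hi : 0 < i) : IsGapSeq p n (gapLift p n P i v) where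
  zero := by simp [_root_.gapLift, hP.zero, hi.ne', hv]
  le j := by
    have := hP.le j
    simp only [_root_.gapLift]; split_ifs <;> omega
  lower j := by
    have h1 := hP.lower j
    have h2 := hP.le j
    simp only [_root_.gapLift]
    rcases lt_trichotomy i (j + 1) with h | h | h
    · rw [if_pos (by omega), if_pos (by omega)]; omega
    · subst h
      simp only [add_tsub_cancel_left, le_refl, if_true, if_neg (show ¬ j + 1 ≤ j by omega)]
      omega
    · obtain ⟨d, rfl⟩ := Nat.exists_eq_add_of_lt h
      rw [if_neg (by omega), if_neg (by omega), show j + 1 + d + 1 - j = d + 1 + 1 by omega,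
        show j + 1 + d + 1 - (j + 1) = d + 1 by omega, mul_add p (d + 1) 1]
      omega
  upper j := by
    have h1 := hP.upper j
    simp only [_root_.gapLift]
    rcases lt_trichotomy i (j + 1) with h | h | h
    · rw [if_pos (by omega), if_pos (by omega)]; omega
    · subst h
      simp only [add_tsub_cancel_left, le_refl, if_true, if_neg (show ¬ j + 1 ≤ j by omega)]
      omega
    · obtain ⟨d, rfl⟩ := Nat.exists_eq_add_of_lt h
      rw [if_neg (by omega), if_neg (by omega), show j + 1 + d + 1 - j = d + 1 + 1 by omega,
        show j + 1 + d + 1 - (j + 1) = d + 1 by omega, mul_add p (d + 1) 1]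
      omega

/-- Leastness of the lift: a value at least `v` at index `i` forces growth by one per index to the
right, capped at `n`, and a decrease of at most `p` per index to the left. -/
theorem gapLift_le {p n : ℕ} {P Q : ℕ → ℕ} (hQ : IsGapSeq p n Q) (hPQ : P ≤ Q)
    {i v : ℕ} (hv : v ≤ Q i) : gapLift p n P i v ≤ Q := by
  intro j
  have h : P j ≤ Q j := hPQ j
  simp only [gapLift]
  split_ifs with hij
  · obtain ⟨d, rfl⟩ := Nat.exists_eq_add_of_le hij
    have := hQ.lower_add i d
    rw [Nat.add_sub_cancel_left]; omega
  · obtain ⟨d, rfl⟩ := Nat.exists_eq_add_of_lt (not_le.1 hij)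
    have := hQ.upper_add j (d + 1)
    rw [show j + d + 1 - j = d + 1 by omega]
    rw [← add_assoc] at this; omega

/-- Any two elementary increments between `P` and `Q` are forced to occur in a definite order. -/
def Aligned (p : ℕ) (P Q : ℕ → ℕ) : Prop :=
  ∀ i j v w, i < j → P i < v → v ≤ Q i → P j < w → w ≤ Q j →
    w ≤ v + (j - i) ∨ v + p * (j - i) ≤ w

/-- Compare the lifts of `P` to `v` at `i` and to `w` at `j`. The first lies below the second only
if `v ≤ w - p * (j - i)`, the reverse holds only if `w ≤ v + (j - i)`; these are the two
alternatives of `Aligned`. -/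
theorem aligned_of_linear {p n : ℕ} (hp : 1 ≤ p) {P Q : ℕ → ℕ} (hP : IsGapSeq p n P)
    (hQ : IsGapSeq p n Q) (hPQ : P ≤ Q)
    (h : ∀ R S, IsGapSeq p n R → IsGapSeq p n S → P ≤ R → R ≤ Q → P ≤ S → S ≤ Q →
      R ≤ S ∨ S ≤ R) : Aligned p P Q := by
  intro i j v w hij hv hv' hw hw'
  have hi : 0 < i := by
    rcases Nat.eq_zero_or_pos i with rfl | h0
    · rw [hQ.zero] at hv'; omega
    · exact h0
  have := h (gapLift p n P i v) (gapLift p n P j w)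
    (hP.gapLift hp (hv'.trans (hQ.le_mul i)) (hv'.trans (hQ.le i)) hi)
    (hP.gapLift hp (hw'.trans (hQ.le_mul j)) (hw'.trans (hQ.le j)) (by omega))
    (fun k => le_max_left _ _) (gapLift_le hQ hPQ hv') (fun k => le_max_left _ _)
    (gapLift_le hQ hPQ hw')
  have hjn := hQ.le j
  rcases this with h1 | h1
  · right
    have := h1 i
    simp only [gapLift, le_refl, if_true, if_neg (not_le.2 hij), Nat.sub_self] at this
    have := hQ.le i
    omega
  · left
    have := h1 j
    simp only [gapLift, le_refl, if_true, if_pos hij.le, Nat.sub_self] at this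
    omega

/-- Incomparable `R`, `S` cross, say `R i < S i` and `S j < R j` with `i < j`. Alignment of `S i`
with `R j` then contradicts either the minimal growth of `S` or the maximal growth of `R`. -/
theorem linear_of_aligned {p n : ℕ} {P Q : ℕ → ℕ} (h : Aligned p P Q) {R S : ℕ → ℕ}
    (hR : IsGapSeq p n R) (hS : IsGapSeq p n S) (hPR : P ≤ R) (hRQ : R ≤ Q) (hPS : P ≤ S)
    (hSQ : S ≤ Q) : R ≤ S ∨ S ≤ R := by
  by_contra hc
  simp only [not_or, Pi.le_def, not_forall, not_le] at hc
  obtain ⟨⟨j, hj⟩, i, hi⟩ := hc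
  have key : ∀ {R S : ℕ → ℕ}, IsGapSeq p n R → IsGapSeq p n S → P ≤ R → R ≤ Q → P ≤ S → S ≤ Q →
      ∀ {i j}, R i < S i → S j < R j → i < j → False := by
    intro R S hR hS hPR hRQ hPS hSQ i j hi hj hij
    obtain ⟨d, rfl⟩ := Nat.exists_eq_add_of_lt hij
    have h1 := h i (i + d + 1) (S i) (R (i + d + 1)) hij ((hPR i).trans_lt hi) (hSQ i)
      ((hPS _).trans_lt hj) (hRQ _)
    rw [show i + d + 1 - i = d + 1 by omega] at h1
    have h2 := hS.lower_add i (d + 1)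
    have h3 := hR.upper_add i (d + 1)
    have h4 := hR.le (i + d + 1)
    rw [← add_assoc] at h2 h3
    rw [← add_assoc] at h2
    omega
  rcases lt_trichotomy i j with hij | rfl | hij
  · exact key hR hS hPR hRQ hPS hSQ hi hj hij
  · omega
  · exact key hS hR hPS hSQ hPR hRQ hj hi hij

/-! ### Height of an interval as the sum of the differences. -/

/-- The sum of the increments from `P` to `Q`. -/
def gapHeight (n : ℕ) (P Q : ℕ → ℕ) : ℕ := ∑ i ∈ Finset.range n, (Q i - P i)

theorem gapHeight_eq_range {p n : ℕ} {P Q : ℕ → ℕ} (hP : IsGapSeq p n P) (hQ : IsGapSeq p n Q)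
    {N : ℕ} (hN : n ≤ N) : gapHeight n P Q = ∑ i ∈ Finset.range N, (Q i - P i) := by
  apply Finset.sum_subset (by simpa using hN)
  intro i _ hi
  have : n ≤ i := by simpa using hi
  rw [hP.eq_top this, hQ.eq_top this, Nat.sub_self]

theorem gapHeight_add {n : ℕ} {P Q R : ℕ → ℕ} (h1 : P ≤ Q) (h2 : Q ≤ R) :
    gapHeight n P Q + gapHeight n Q R = gapHeight n P R := by
  simp only [gapHeight, ← Finset.sum_add_distrib]
  refine Finset.sum_congr rfl fun i _ => ?_
  have : P i ≤ Q i := h1 i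
  have : Q i ≤ R i := h2 i
  omega

theorem gapHeight_pos {p n : ℕ} {P Q : ℕ → ℕ} (hP : IsGapSeq p n P) (hQ : IsGapSeq p n Q)
    (h : P < Q) : 0 < gapHeight n P Q := by
  obtain ⟨i, hi⟩ := (Pi.lt_def.1 h).2
  have hin : i < n := by
    by_contra hc
    rw [hP.eq_top (not_lt.1 hc), hQ.eq_top (not_lt.1 hc)] at hi; omega
  have : Q i - P i ≤ gapHeight n P Q :=
    Finset.single_le_sum (f := fun i => Q i - P i) (fun _ _ => Nat.zero_le _)
      (Finset.mem_range.2 hin)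
  omega

theorem exists_unit_increment {p n : ℕ} (hp : 2 ≤ p) {P Q : ℕ → ℕ} (hP : IsGapSeq p n P)
    (hQ : IsGapSeq p n Q) (h : P < Q) :
    ∃ R, IsGapSeq p n R ∧ P ≤ R ∧ R ≤ Q ∧ gapHeight n P R = 1 := by
  classical
  have hle := h.le
  -- `A i` says that raising the term of index `i + 1` by one stays below `Q` and respects the upper
  -- bound on the increment before it.
  let A : ℕ → Prop := fun i => P (i + 1) < Q (i + 1) ∧ P (i + 1) + 1 ≤ P i + p
  have hA : ∃ i, A i := by
    obtain ⟨i, hi⟩ := (Pi.lt_def.1 h).2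
    have hex : ∃ i, P i < Q i := ⟨i, hi⟩
    have h1 := Nat.find_spec hex
    have h2 := fun j => Nat.find_min hex (m := j)
    generalize Nat.find hex = m at h1 h2
    rcases m with _ | m
    · rw [hP.zero, hQ.zero] at h1; omega
    · refine ⟨m, h1, ?_⟩
      have := h2 m (by omega); have := hQ.upper m; omega
  have hb : ∀ i, A i → i + 1 < n := by
    intro i hi
    by_contra hc
    have := hi.1
    rw [hP.eq_top (not_lt.1 hc), hQ.eq_top (not_lt.1 hc)] at this; omega
  obtain ⟨i0, hi0⟩ := hA
  have h1 : A (Nat.findGreatest A n) := Nat.findGreatest_spec (by have := hb _ hi0; omega) hi0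
  have h2 : ∀ k, Nat.findGreatest A n < k → ¬ A k := by
    intro k hk hAk
    exact Nat.findGreatest_is_greatest hk (by have := hb _ hAk; omega) hAk
  -- At the last such index the following increment has room too. Otherwise the next term is `P (m +
  -- 1) + 1 < n`, so it lies below that of `Q` and, as `p ≥ 2`, can itself be raised, contradicting
  -- maximality.
  generalize Nat.findGreatest A n = m at h1 h2
  have h3 := h2 (m + 1) (by omega)
  have hmn := hb _ h1
  obtain ⟨h4, h5⟩ := h1
  have hn : P (m + 1 + 1) ≥ min (P (m + 1) + 2) n := by
    by_contra hc
    apply h3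
    have := hP.lower (m + 1); have := hQ.lower (m + 1)
    constructor <;> omega
  refine ⟨Function.update P (m + 1) (P (m + 1) + 1), ⟨?_, ?_, ?_, ?_⟩, ?_, ?_, ?_⟩
  · rw [Function.update_of_ne (by omega), hP.zero]
  · intro i
    have := hP.le i; have := hQ.le (m + 1)
    by_cases hi : i = m + 1
    · subst hi; rw [Function.update_self]; omega
    · rw [Function.update_of_ne hi]; omega
  · intro i
    have := hP.lower i
    by_cases hi : i = m + 1
    · subst hi; rw [Function.update_self, Function.update_of_ne (by omega)]; omega
    · rw [Function.update_of_ne hi]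
      by_cases hi' : i = m
      · subst hi'; rw [Function.update_self]; omega
      · rw [Function.update_of_ne (by omega)]; omega
  · intro i
    have := hP.upper i
    by_cases hi : i = m + 1
    · subst hi; rw [Function.update_self, Function.update_of_ne (by omega)]; omega
    · rw [Function.update_of_ne hi]
      by_cases hi' : i = m
      · subst hi'; rw [Function.update_self]; omega
      · rw [Function.update_of_ne (by omega)]; omega
  · intro i
    change P i ≤ Function.update P (m + 1) (P (m + 1) + 1) i
    by_cases hi : i = m + 1
    · subst hi; rw [Function.update_self]; omega
    · rw [Function.update_of_ne hi]
  · intro i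
    change Function.update P (m + 1) (P (m + 1) + 1) i ≤ Q i
    by_cases hi : i = m + 1
    · subst hi; rw [Function.update_self]; omega
    · rw [Function.update_of_ne hi]; exact hle i
  · unfold gapHeight
    rw [Finset.sum_eq_single (m + 1)]
    · rw [Function.update_self]; omega
    · intro i _ hi; rw [Function.update_of_ne hi, Nat.sub_self]
    · intro hc; exact absurd (Finset.mem_range.2 hmn) hc

/-- The poset of gap sequences under the pointwise order. -/
abbrev GapSeq (p n : ℕ) : Type := {s : ℕ → ℕ // IsGapSeq p n s}

theorem GapSeq.exists_series {p n : ℕ} (hp : 2 ≤ p) (k : ℕ) : ∀ P Q : GapSeq p n, P ≤ Q →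
    gapHeight n P Q = k → ∃ l : LTSeries (GapSeq p n), l.length = k ∧ l.head = P ∧ l.last = Q := by
  induction k with
  | zero =>
    intro P Q h hk
    have : P = Q := by
      by_contra hne
      have := gapHeight_pos P.2 Q.2 (lt_of_le_of_ne h fun hc => hne (Subtype.ext hc))
      omega
    subst this
    exact ⟨RelSeries.singleton _ P, rfl, rfl, rfl⟩
  | succ k ih =>
    intro P Q h hk
    have hlt : P < Q := by
      refine lt_of_le_of_ne h ?_
      rintro rfl
      simp [gapHeight] at hk
    obtain ⟨R, hR, h1, h2, h3⟩ := exists_unit_increment hp P.2 Q.2 hlt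
    have h4 := gapHeight_add (n := n) h1 h2
    obtain ⟨l, hl, hh, hlast⟩ := ih ⟨R, hR⟩ Q h2 (by simp only; omega)
    refine ⟨l.cons P ?_, ?_, ?_, ?_⟩
    · rw [hh]
      refine lt_of_le_of_ne h1 ?_
      rintro rfl
      simp [gapHeight] at h3
    · simp [hl]
    · simp
    · simp [hlast]

/-- Distance from `P` is strictly monotone with values up to `gapHeight n P Q`, which bounds chains
from above; unit increments produce a chain attaining the bound. -/
theorem GapSeq.krullDim_Icc {p n : ℕ} (hp : 2 ≤ p) {P Q : GapSeq p n} (h : P ≤ Q) :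
    Order.krullDim (Set.Icc P Q) = ((gapHeight n P Q : ℕ) : WithBot ℕ∞) := by
  apply le_antisymm
  · have hm : StrictMono (fun R : Set.Icc P Q => (⟨gapHeight n P R.1, by
        have := gapHeight_add (n := n) R.2.1 R.2.2; omega⟩ : Fin (gapHeight n P Q + 1))) := by
      intro R S hRS
      have h1 := gapHeight_pos R.1.2 S.1.2 hRS
      have h2 := gapHeight_add (n := n) R.2.1 (show R.1 ≤ S.1 from hRS.le)
      change gapHeight n P R.1 < gapHeight n P S.1
      omega
    refine (Order.krullDim_le_of_strictMono _ hm).trans (iSup_le fun l => ?_)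
    have := l.length_lt_card
    rw [Fintype.card_fin] at this
    exact_mod_cast Nat.lt_succ_iff.1 this
  · obtain ⟨l, hl, hh, hlast⟩ := GapSeq.exists_series hp _ P Q h rfl
    have hmem : ∀ i, l i ∈ Set.Icc P Q := fun i =>
      ⟨hh ▸ LTSeries.head_le l i, hlast ▸ l.monotone (Fin.le_last i)⟩
    let l' : LTSeries (Set.Icc P Q) :=
      { length := l.length, toFun := fun i => ⟨l i, hmem i⟩, step := fun i => l.step i }
    have := Order.LTSeries.length_le_krullDim l'
    rwa [show l'.length = gapHeight n P Q from hl] at this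

/-! ### Classification of the aligned pairs. -/

/-- The differing indices form one block. If the sequences differed again right after an agreement,
the common value there would put the next term of `P`, plus one, strictly between the two thresholds
that alignment with `Q i` imposes. -/
theorem Aligned.eq_of_eq {p n : ℕ} {P Q : ℕ → ℕ} (h : Aligned p P Q) (hP : IsGapSeq p n P)
    (hQ : IsGapSeq p n Q) (hPQ : P ≤ Q) {i : ℕ} (hi : P i < Q i) (hi' : P (i + 1) = Q (i + 1))
    (d : ℕ) : P (i + 1 + d) = Q (i + 1 + d) := by
  induction d with
  | zero => exact hi'
  | succ d ih =>
    by_contra hne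
    have hle : P (i + 1 + d + 1) ≤ Q (i + 1 + d + 1) := hPQ _
    rw [← add_assoc] at hne
    have h1 := h i (i + 1 + d + 1) (Q i) (P (i + 1 + d + 1) + 1) (by omega) hi le_rfl (by omega)
      (by omega)
    rw [show i + 1 + d + 1 - i = d + 1 + 1 by omega, mul_add] at h1
    have h2 := hQ.lower_add i (d + 1)
    have h3 := hP.upper_add i (d + 1)
    rw [show i + (d + 1) = i + 1 + d by ring] at h2 h3
    have h4 := hP.lower (i + 1 + d)
    have h5 := hQ.upper (i + 1 + d)
    have h6 := hQ.le (i + 1 + d + 1)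
    omega

/-- It suffices to test alignment at the extreme values and at `P i + 2` and `P i + 3`. -/
theorem Aligned.adjacent {p n : ℕ} (hp : 3 ≤ p) {P Q : ℕ → ℕ} (h : Aligned p P Q)
    (hP : IsGapSeq p n P) (hQ : IsGapSeq p n Q) {i : ℕ} (hi : P i < Q i)
    (hi' : P (i + 1) < Q (i + 1)) :
    (Q i = P i + 1 ∧ P (i + 1) = P i + p ∧ Q (i + 1) = Q i + p) ∨
    (Q i = P i + 1 ∧ P (i + 1) = P i + 1 ∧ Q (i + 1) = Q i + 1) ∨
    (P i + 2 = n ∧ Q i = n ∧ P (i + 1) + 1 = n) := by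
  have key : ∀ v w, P i < v → v ≤ Q i → P (i + 1) < w → w ≤ Q (i + 1) → w ≤ v + 1 ∨ v + p ≤ w := by
    intro v w h1 h2 h3 h4
    simpa using h i (i + 1) v w (by omega) h1 h2 h3 h4
  have h1 := hP.lower i
  have h2 := hP.upper i
  have h3 := hQ.lower i
  have h4 := hQ.upper i
  have h5 := hQ.le (i + 1)
  have h6 := hQ.le i
  have k1 := key (Q i) (P (i + 1) + 1) hi le_rfl (by omega) hi'
  have k2 := key (P i + 1) (Q (i + 1)) (by omega) hi hi' le_rfl
  have k3 := key (P i + 1) (P (i + 1) + 1) (by omega) hi (by omega) hi'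
  have k4 : Q i < P i + 2 ∨ P (i + 1) + 1 ≤ P i + 2 + 1 ∨ P i + 2 + p ≤ P (i + 1) + 1 := by
    by_cases hh : Q i < P i + 2
    · exact Or.inl hh
    · exact Or.inr (key _ _ (by omega) (by omega) (by omega) hi')
  -- With `v = P i + 1`, the value `P i + 3` violates both alternatives precisely because `p ≥ 3`.
  -- So the next terms lie on one side of it, which separates the steps `1` and `p`; for `p = 2`
  -- adjacent indices would impose no constraint.
  have k5 : Q (i + 1) < P i + 3 ∨ P i + 3 ≤ P (i + 1) ∨ P i + 3 ≤ P i + 1 + 1 ∨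
      P i + 1 + p ≤ P i + 3 := by
    by_cases hh : Q (i + 1) < P i + 3
    · exact Or.inl hh
    by_cases hh' : P i + 3 ≤ P (i + 1)
    · exact Or.inr (Or.inl hh')
    · exact Or.inr (Or.inr (key _ _ (by omega) hi (by omega) (by omega)))
  omega

/-- `P` and `Q` agree except for their terms of indices `1, …, m`; these are arithmetic
progressions with common difference `q`, that of `Q` starts from `j`, and that of `P` is
lower by `d`. -/
def StairPair (j d q m : ℕ) (P Q : ℕ → ℕ) : Prop :=
  (∀ i < m, P (i + 1) + d = j + i * q ∧ Q (i + 1) = j + i * q) ∧ ∀ i, m ≤ i → P (i + 1) = Q (i + 1)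

theorem StairPair.aligned {p n j d q m : ℕ} {P Q : ℕ → ℕ} (hP : IsGapSeq p n P)
    (hQ : IsGapSeq p n Q) (h : StairPair j d q m P Q)
    (hc : m = 1 ∨ d = 1 ∧ (q = 1 ∨ q = p)) : Aligned p P Q := by
  intro i j v w hij h1 h2 h3 h4
  rcases i with _ | i
  · rw [hQ.zero] at h2; omega
  rcases j with _ | j
  · omega
  have hjm : j < m := by
    by_contra hh
    have := h.2 j (by omega); omega
  have a1 := h.1 i (by omega)
  have a2 := h.1 j hjm
  obtain ⟨e, rfl⟩ := Nat.exists_eq_add_of_lt (show i < j by omega)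
  rcases hc with rfl | ⟨rfl, hq⟩
  · omega
  · rw [show i + e + 1 + 1 - (i + 1) = e + 1 by omega]
    rw [add_assoc i e 1, add_mul] at a2
    rcases hq with rfl | rfl
    · left; rw [← add_assoc] at a2; omega
    · right; rw [mul_comm q (e + 1)]; rw [← add_assoc i e 1] at a2; omega

theorem StairPair.of_adjacent {j d q m : ℕ} {P Q : ℕ → ℕ} (h0 : P 1 + d = j) (h0' : Q 1 = j)
    (h1 : ∀ i, i + 1 < m → P (i + 1 + 1) = P (i + 1) + q ∧ Q (i + 1 + 1) = Q (i + 1) + q)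
    (h2 : ∀ i, m ≤ i → P (i + 1) = Q (i + 1)) : StairPair j d q m P Q := by
  refine ⟨fun i => ?_, h2⟩
  induction i with
  | zero => intro _; simp [h0, h0']
  | succ i ih =>
    intro hi
    have := ih (by omega)
    have := h1 i hi
    rw [add_mul]; omega

theorem aligned_iff {p n : ℕ} (hp : 3 ≤ p) {P Q : ℕ → ℕ} (hP : IsGapSeq p n P)
    (hQ : IsGapSeq p n Q) (hPQ : P ≤ Q) (h1 : P 1 < Q 1) :
    Aligned p P Q ↔ StairPair (Q 1) (Q 1 - P 1) 1 1 P Q ∨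
      (∃ m, 2 ≤ m ∧ StairPair (Q 1) 1 p m P Q) ∨ (∃ m, 2 ≤ m ∧ StairPair (Q 1) 1 1 m P Q) ∨
      (P 1 + 2 = n ∧ Q 1 = n ∧ P 2 + 1 = n) := by
  constructor
  · intro h
    -- The first agreement after index `0` ends the block of differing indices.
    have hex : ∃ i, P (i + 1) = Q (i + 1) :=
      ⟨n, by rw [hP.eq_top (Nat.le_succ n), hQ.eq_top (Nat.le_succ n)]⟩
    have f1 := Nat.find_spec hex
    have f2 := fun j => Nat.find_min hex (m := j)
    generalize Nat.find hex = m at f1 f2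
    have hlt : ∀ i < m, P (i + 1) < Q (i + 1) := fun i hi => lt_of_le_of_ne (hPQ _) (f2 i hi)
    rcases m with _ | m
    · simp at f1; omega
    have heq : ∀ i, m + 1 ≤ i → P (i + 1) = Q (i + 1) := by
      intro i hi
      obtain ⟨e, rfl⟩ := Nat.exists_eq_add_of_le hi
      have := h.eq_of_eq hP hQ hPQ (hlt m (by omega)) f1 e
      rwa [show m + 1 + e + 1 = m + 1 + 1 + e by ring]
    rcases m with _ | m
    · left
      exact StairPair.of_adjacent (by omega) rfl (fun i hi => by omega) heq
    right
    have adj : ∀ i, i < m + 1 → _ := fun i hi =>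
      h.adjacent hp hP hQ (hlt i (by omega)) (hlt (i + 1) (by omega))
    rcases adj 0 (by omega) with c | c | c
    · left
      refine ⟨m + 2, by omega, StairPair.of_adjacent c.1.symm rfl ?_ heq⟩
      have : ∀ i, i < m + 1 → Q (i + 1) = P (i + 1) + 1 ∧ P (i + 1 + 1) = P (i + 1) + p ∧
          Q (i + 1 + 1) = Q (i + 1) + p := by
        intro i
        induction i with
        | zero => intro _; exact c
        | succ i ih =>
          intro hi
          have k1 := ih (by omega)
          have k2 := adj (i + 1) hi
          -- Indices at distance two forbid a change of step: an increase of `p + 1` over two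
          -- indices lies strictly between `2` and `2 * p`. The exceptional shape is also excluded,
          -- since it needs a difference of two.
          have k3 := h (i + 1) (i + 1 + 1 + 1) (Q (i + 1)) (Q (i + 1 + 1 + 1)) (by omega)
            (by omega) le_rfl (hlt _ (by omega)) le_rfl
          rw [show i + 1 + 1 + 1 - (i + 1) = 2 by omega] at k3
          omega
      exact fun i hi => (this i (by omega)).2
    · right; left
      refine ⟨m + 2, by omega, StairPair.of_adjacent c.1.symm rfl ?_ heq⟩
      have : ∀ i, i < m + 1 → Q (i + 1) = P (i + 1) + 1 ∧ P (i + 1 + 1) = P (i + 1) + 1 ∧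
          Q (i + 1 + 1) = Q (i + 1) + 1 := by
        intro i
        induction i with
        | zero => intro _; exact c
        | succ i ih =>
          intro hi
          have k1 := ih (by omega)
          have k2 := adj (i + 1) hi
          have k3 := h (i + 1) (i + 1 + 1 + 1) (Q (i + 1)) (Q (i + 1 + 1 + 1)) (by omega)
            (by omega) le_rfl (hlt _ (by omega)) le_rfl
          rw [show i + 1 + 1 + 1 - (i + 1) = 2 by omega] at k3
          omega
      exact fun i hi => (this i (by omega)).2
    · right; right; exact c
  · rintro (h | ⟨m, -, h⟩ | ⟨m, -, h⟩ | h)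
    · exact h.aligned hP hQ (Or.inl rfl)
    · exact h.aligned hP hQ (Or.inr ⟨rfl, Or.inr rfl⟩)
    · exact h.aligned hP hQ (Or.inr ⟨rfl, Or.inl rfl⟩)
    · intro i j v w hij h2 h3 h4 h5
      -- Only the indices `1` and `2` can differ, and the only value to reach at index `2` is `n`,
      -- at most one more than any admissible `v`.
      have htop : ∀ e, P (3 + e) = n := by
        intro e
        have a1 := hP.lower 2
        have a2 := hP.mono (show 3 ≤ 3 + e by omega)
        have a3 := hP.le (3 + e)
        simp only [Nat.reduceAdd] at a1
        omega
      have hj : j < 3 := by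
        by_contra hc
        obtain ⟨e, rfl⟩ := Nat.exists_eq_add_of_le (not_lt.1 hc)
        have := htop e; have := hQ.le (3 + e); omega
      have := hQ.le j
      rcases i with _ | i
      · rw [hQ.zero] at h3; omega
      · obtain ⟨rfl, rfl⟩ : i = 0 ∧ j = 2 := by omega
        simp only [zero_add] at *
        omega

theorem StairPair.gapHeight {p n j d q m : ℕ} {P Q : ℕ → ℕ} (hP : IsGapSeq p n P)
    (hQ : IsGapSeq p n Q) (hd : 0 < d) (h : StairPair j d q m P Q) : gapHeight n P Q = m * d := by
  have hm : m ≤ n := by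
    rcases m with _ | m
    · omega
    · by_contra hc
      have := h.1 m (by omega)
      rw [hP.eq_top (by omega), hQ.eq_top (by omega)] at this
      omega
  rw [gapHeight_eq_range hP hQ (Nat.le_succ n), Finset.sum_range_succ', hP.zero, hQ.zero]
  simp only [Nat.sub_self, add_zero]
  rw [← Finset.sum_subset (Finset.range_mono hm)]
  · rw [Finset.sum_congr rfl (g := fun _ => d), Finset.sum_const, Finset.card_range, smul_eq_mul]
    intro i hi
    have := h.1 i (Finset.mem_range.1 hi); omega
  · intro i _ hi
    rw [h.2 i (by simpa using hi), Nat.sub_self]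

theorem gapHeight_eq_three {p n : ℕ} {P Q : ℕ → ℕ} (hP : IsGapSeq p n P)
    (hQ : IsGapSeq p n Q) (h : P 1 + 2 = n ∧ Q 1 = n ∧ P 2 + 1 = n) : gapHeight n P Q = 3 := by
  have a1 := hP.lower 2
  have a2 := hQ.lower 1
  have a3 := hQ.le 2
  simp only [Nat.reduceAdd] at a1 a2
  rw [gapHeight_eq_range hP hQ (show n ≤ 3 + n by omega), Finset.sum_range_add]
  rw [Finset.sum_eq_zero (s := Finset.range n)]
  · simp only [Finset.sum_range_succ, Finset.sum_range_zero, hP.zero, hQ.zero]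
    omega
  · intro e _
    have b1 := hP.mono (show 3 ≤ 3 + e by omega)
    have b2 := hQ.le (3 + e)
    omega

/-! ### Splitting off the first term. -/

theorem finite_setOf_isGapSeq (p n : ℕ) : {s | IsGapSeq p n s}.Finite := by
  have : Finite (GapSeq p n) := by
    refine Finite.of_injective (β := Fin n → Fin (n + 1))
      (fun s i => ⟨s.1 i, Nat.lt_succ_of_le (s.2.le i)⟩) fun s t h => Subtype.ext (funext fun i => ?_)
    by_cases hi : i < n
    · simpa using congrFun h ⟨i, hi⟩
    · rw [s.2.eq_top (not_lt.1 hi), t.2.eq_top (not_lt.1 hi)]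
  exact Set.finite_coe_iff.1 this

theorem Set.Finite.ncard_eq_sum_fiber {α ι : Type*} [DecidableEq ι] {A : Set α} (hA : A.Finite)
    (g : α → ι) (I : Finset ι) (hg : ∀ x ∈ A, g x ∈ I) :
    A.ncard = ∑ i ∈ I, {x | x ∈ A ∧ g x = i}.ncard := by
  classical
  rw [Set.ncard_eq_toFinset_card A hA, Finset.card_eq_sum_card_fiberwise (f := g) (t := I)]
  · refine Finset.sum_congr rfl fun i _ => ?_
    rw [← Set.ncard_coe_finset]
    congr 1
    ext x; simp
  · intro x hx; exact hg x (by simpa using hx)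

/-- The sequence that follows `u` up to index `m` and then continues with the increments of `r`. -/
def splice (u : ℕ → ℕ) (m : ℕ) (r : ℕ → ℕ) : ℕ → ℕ := fun i =>
  if i ≤ m then u i else u m + r (i - m)

/-- The increments of `s` from index `m` on. -/
def gapTail (m : ℕ) (s : ℕ → ℕ) : ℕ → ℕ := fun i => s (m + i) - s m

theorem gapTail_splice (u : ℕ → ℕ) (m : ℕ) {r : ℕ → ℕ} (hr : r 0 = 0) :
    gapTail m (splice u m r) = r := by
  funext i
  rcases i with _ | i
  · simp [gapTail, hr]
  · simp [gapTail, splice]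

theorem splice_apply_add (u : ℕ → ℕ) (m : ℕ) {r : ℕ → ℕ} (hr : r 0 = 0) (i : ℕ) :
    splice u m r (m + i) = u m + r i := by
  rcases i with _ | i
  · simp [splice, hr]
  · simp [splice]

theorem splice_gapTail {p n m : ℕ} {u s : ℕ → ℕ} (hs : IsGapSeq p n s) (h : ∀ i ≤ m, s i = u i) :
    splice u m (gapTail m s) = s := by
  funext i
  by_cases hi : i ≤ m
  · simp [splice, hi, h]
  · obtain ⟨d, rfl⟩ := Nat.exists_eq_add_of_lt (not_le.1 hi)
    have := hs.mono (show m ≤ m + d + 1 by omega)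
    have := h m le_rfl
    simp only [splice, gapTail, if_neg hi]
    rw [show m + (m + d + 1 - m) = m + d + 1 by omega]
    omega

theorem IsGapSeq.gapTail {p n : ℕ} {s : ℕ → ℕ} (hs : IsGapSeq p n s) (m : ℕ) :
    IsGapSeq p (n - s m) (gapTail m s) where
  zero := by simp [_root_.gapTail]
  le i := by have := hs.le (m + i); simp only [_root_.gapTail]; omega
  lower i := by
    have := hs.lower (m + i); have := hs.le m
    have := hs.mono (show m ≤ m + i by omega)
    simp only [_root_.gapTail, ← add_assoc]; omega
  upper i := by
    have := hs.upper (m + i)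
    simp only [_root_.gapTail, ← add_assoc]; omega

theorem IsGapSeq.splice {p n m : ℕ} {u r : ℕ → ℕ} (h0 : u 0 = 0)
    (hu : ∀ i < m, u i < u (i + 1) ∧ u (i + 1) ≤ u i + p) (hn : u m ≤ n)
    (hr : IsGapSeq p (n - u m) r) : IsGapSeq p n (splice u m r) := by
  have hle : ∀ d i, i + d = m → u i ≤ u m := by
    intro d
    induction d with
    | zero => rintro i rfl; rfl
    | succ d ih =>
      intro i hi
      exact (hu i (by omega)).1.le.trans (ih (i + 1) (by omega))
  have hadd := splice_apply_add u m hr.zero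
  refine ⟨by simp [_root_.splice, h0], fun i => ?_, fun i => ?_, fun i => ?_⟩
  · by_cases hi : i ≤ m
    · have := hle (m - i) i (by omega)
      simp only [_root_.splice, if_pos hi]; omega
    · obtain ⟨d, rfl⟩ := Nat.exists_eq_add_of_le (not_le.1 hi).le
      have := hr.le d
      rw [hadd]; omega
  · by_cases hi : i < m
    · have := (hu i hi).1
      simp only [_root_.splice, if_pos hi.le, if_pos (Nat.succ_le_of_lt hi)]; omega
    · obtain ⟨d, rfl⟩ := Nat.exists_eq_add_of_le (not_lt.1 hi)
      have := hr.lower d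
      rw [add_assoc, hadd, hadd]; omega
  · by_cases hi : i < m
    · have := (hu i hi).2
      simp only [_root_.splice, if_pos hi.le, if_pos (Nat.succ_le_of_lt hi)]; omega
    · obtain ⟨d, rfl⟩ := Nat.exists_eq_add_of_le (not_lt.1 hi)
      have := hr.upper d
      rw [add_assoc, hadd, hadd]; omega

theorem IsGapSeq.one_le {p n : ℕ} {s : ℕ → ℕ} (hs : IsGapSeq p n s) (hn : 0 < n) : 1 ≤ s 1 := by
  have := hs.min_le 1; omega

/-- The prefix `i * v` is read only at the indices `0` and `1`; it serves to place a first term `v`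
in front of `r`. -/
theorem IsGapSeq.splice_one {p n v : ℕ} {r : ℕ → ℕ} (hv : 1 ≤ v) (hvp : v ≤ p) (hn : v ≤ n)
    (hr : IsGapSeq p (n - v) r) : IsGapSeq p n (_root_.splice (fun i => i * v) 1 r) :=
  IsGapSeq.splice (by simp) (fun i hi => by
    obtain rfl : i = 0 := by omega
    simp; omega) (by simpa using hn) (by simpa using hr)

/-- The number of gap sequences whose first term is at most `p - d`. -/
noncomputable def gapSeqCount (p d n : ℕ) : ℕ := {s | IsGapSeq p n s ∧ s 1 + d ≤ p}.ncard

theorem gapSeqCount_zero_eq (p n : ℕ) : gapSeqCount p 0 n = {s | IsGapSeq p n s}.ncard := by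
  unfold gapSeqCount
  congr 1
  ext s
  refine ⟨fun h => h.1, fun h => ⟨h, ?_⟩⟩
  have h : IsGapSeq p n s := h
  have := h.upper 0; have := h.zero
  simp only [zero_add] at *
  omega

theorem gapSeqCount_at_zero {p d : ℕ} (hd : d ≤ p) : gapSeqCount p d 0 = 1 := by
  rw [gapSeqCount, Set.ncard_eq_one]
  refine ⟨fun _ => 0, Set.eq_singleton_iff_unique_mem.2 ⟨⟨⟨rfl, by simp, by simp, by simp⟩, by simpa⟩, ?_⟩⟩
  rintro s ⟨hs, -⟩
  funext i
  simpa using hs.le i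

/-- Once the first term `v` is removed, the tail is an arbitrary gap sequence for `n - v`; the
restriction by `d` concerns `v` only. -/
theorem gapSeqCount_of_pos {p d n : ℕ} (hn : 0 < n) :
    gapSeqCount p d n =
      ∑ v ∈ Finset.Icc 1 (p - d), if v ≤ n then gapSeqCount p 0 (n - v) else 0 := by
  rw [gapSeqCount, Set.Finite.ncard_eq_sum_fiber ((finite_setOf_isGapSeq p n).subset fun s h => h.1)
    (fun s => s 1) (Finset.Icc 1 (p - d))]
  · refine Finset.sum_congr rfl fun v hv => ?_
    rw [Finset.mem_Icc] at hv
    split_ifs with hvn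
    · rw [gapSeqCount_zero_eq]
      symm
      refine Set.BijOn.ncard_eq (f := splice (fun i => i * v) 1)
        (Set.InvOn.bijOn (f' := gapTail 1) ⟨?_, ?_⟩ ?_ ?_)
      · exact fun r hr => gapTail_splice _ _ (IsGapSeq.zero hr)
      · rintro s ⟨⟨hs, -⟩, rfl⟩
        exact splice_gapTail hs fun i hi => by interval_cases i <;> simp [hs.zero]
      · intro r hr
        refine ⟨⟨IsGapSeq.splice_one hv.1 (by omega) hvn hr, ?_⟩, ?_⟩ <;> simp [splice]
        omega
      · rintro s ⟨⟨hs, -⟩, rfl⟩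
        exact hs.gapTail 1
    · rw [Set.ncard_eq_zero ((finite_setOf_isGapSeq p n).subset fun s h => h.1.1)]
      ext s
      simp only [Set.mem_ofPred_eq, Set.mem_empty_iff_false, iff_false, not_and, and_imp]
      rintro hs - rfl
      exact hvn (hs.le 1)
  · rintro s ⟨hs, hd⟩
    rw [Finset.mem_Icc]
    have := hs.one_le hn
    omega

theorem aligned_gapTail_iff {p n : ℕ} {P Q : ℕ → ℕ} (hP : IsGapSeq p n P) (hQ : IsGapSeq p n Q)
    (h1 : P 1 = Q 1) : Aligned p (gapTail 1 P) (gapTail 1 Q) ↔ Aligned p P Q := by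
  have hP1 : ∀ i, P 1 ≤ P (1 + i) := fun i => hP.mono (by omega)
  have hQ1 : ∀ i, Q 1 ≤ Q (1 + i) := fun i => hQ.mono (by omega)
  constructor
  · intro h i j v w hij a b c d
    rcases i with _ | i
    · rw [hQ.zero] at b; omega
    rcases j with _ | j
    · omega
    rw [Nat.add_comm] at a b c d
    have := hP1 i; have := hP1 j; have := hQ1 i; have := hQ1 j
    have := h i j (v - P 1) (w - P 1) (by omega) (by simp only [gapTail]; omega)
      (by simp only [gapTail]; omega) (by simp only [gapTail]; omega)
      (by simp only [gapTail]; omega)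
    rw [show j + 1 - (i + 1) = j - i by omega]
    omega
  · intro h i j v w hij a b c d
    simp only [gapTail] at a b c d
    have := hP1 i; have := hP1 j; have := hQ1 i; have := hQ1 j
    have := h (1 + i) (1 + j) (v + P 1) (w + P 1) (by omega) (by omega) (by omega) (by omega)
      (by omega)
    rw [show 1 + j - (1 + i) = j - i by omega] at this
    omega

theorem gapHeight_gapTail {p n : ℕ} {P Q : ℕ → ℕ} (hP : IsGapSeq p n P) (hQ : IsGapSeq p n Q)
    (h1 : P 1 = Q 1) : gapHeight (n - P 1) (gapTail 1 P) (gapTail 1 Q) = gapHeight n P Q := by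
  rw [gapHeight_eq_range (hP.gapTail 1) (h1 ▸ hQ.gapTail 1) (Nat.sub_le n (P 1)),
    gapHeight_eq_range hP hQ (Nat.le_succ n), Finset.sum_range_succ', hP.zero, hQ.zero]
  simp only [Nat.sub_self, add_zero]
  refine Finset.sum_congr rfl fun i _ => ?_
  have := hP.mono (show 1 ≤ 1 + i by omega)
  have := hQ.mono (show 1 ≤ 1 + i by omega)
  simp only [gapTail, add_comm i 1]
  omega

/-- Pairs of gap sequences, the first weakly below the second. -/
def GapPairs (p n : ℕ) : Set ((ℕ → ℕ) × (ℕ → ℕ)) :=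
  {x | IsGapSeq p n x.1 ∧ IsGapSeq p n x.2 ∧ x.1 ≤ x.2}

theorem finite_gapPairs (p n : ℕ) : (GapPairs p n).Finite :=
  ((finite_setOf_isGapSeq p n).prod (finite_setOf_isGapSeq p n)).subset fun _ h => ⟨h.1, h.2.1⟩

theorem finite_of_subset_gapPairs {p n : ℕ} {A : Set ((ℕ → ℕ) × (ℕ → ℕ))}
    (h : ∀ x ∈ A, x ∈ GapPairs p n) : A.Finite := (finite_gapPairs p n).subset h

/-- The pairs of gap sequences that bound a linear interval of height `k`. -/
def LinearPairs (p n k : ℕ) : Set ((ℕ → ℕ) × (ℕ → ℕ)) :=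
  {x | x ∈ GapPairs p n ∧ Aligned p x.1 x.2 ∧ gapHeight n x.1 x.2 = k}

/-- The pairs of gap sequences with distinct first terms that bound a linear interval of
height `k`. -/
def ActivePairs (p n k : ℕ) : Set ((ℕ → ℕ) × (ℕ → ℕ)) :=
  {x | x ∈ LinearPairs p n k ∧ x.1 1 < x.2 1}

theorem ncard_linearPairs_zero (p k : ℕ) :
    (LinearPairs p 0 k).ncard = if k = 0 then 1 else 0 := by
  split_ifs with hk
  · subst hk
    rw [Set.ncard_eq_one]
    refine ⟨(fun _ => 0, fun _ => 0), Set.eq_singleton_iff_unique_mem.2 ⟨⟨⟨⟨rfl, by simp, by simp,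
      by simp⟩, ⟨rfl, by simp, by simp, by simp⟩, le_rfl⟩, ?_, by simp [gapHeight]⟩, ?_⟩⟩
    · intro i j v w _ h h'; simp only at h h'; omega
    · rintro ⟨P, Q⟩ ⟨⟨hP, hQ, -⟩, -⟩
      refine Prod.ext (funext fun i => ?_) (funext fun i => ?_)
      · simpa using hP.le i
      · simpa using hQ.le i
  · rw [Set.ncard_eq_zero (finite_of_subset_gapPairs fun x h => h.1)]
    ext x
    simp only [LinearPairs, gapHeight, Finset.range_zero, Finset.sum_empty, Set.mem_ofPred_eq,
      Set.mem_empty_iff_false, iff_false]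
    rintro ⟨-, -, h⟩
    exact hk h.symm

theorem activePairs_zero (p k : ℕ) : ActivePairs p 0 k = ∅ := by
  ext x
  simp only [Set.mem_empty_iff_false, iff_false]
  rintro ⟨⟨⟨-, hQ, -⟩, -⟩, h⟩
  have := hQ.le 1; omega

/-- Pairs with common first term `v` correspond to their tails, since `Aligned` and `gapHeight`
depend only on the terms where the bounds differ. The remaining pairs are the active ones. -/
theorem ncard_linearPairs_of_pos {p n k : ℕ} (hn : 0 < n) :
    (LinearPairs p n k).ncard =
      (∑ v ∈ Finset.Icc 1 p, if v ≤ n then (LinearPairs p (n - v) k).ncard else 0) +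
        (ActivePairs p n k).ncard := by
  have hsplit : LinearPairs p n k = {x | x ∈ LinearPairs p n k ∧ x.1 1 = x.2 1} ∪
      ActivePairs p n k := by
    ext x
    constructor
    · intro h
      rcases eq_or_lt_of_le (show x.1 1 ≤ x.2 1 from h.1.2.2 1) with h1 | h1
      · exact Or.inl ⟨h, h1⟩
      · exact Or.inr ⟨h, h1⟩
    · rintro (h | h) <;> exact h.1
  rw [hsplit, Set.ncard_union_eq ?_ (finite_of_subset_gapPairs fun x h => h.1.1)
    (finite_of_subset_gapPairs fun x h => h.1.1)]
  swap
  · rw [Set.disjoint_left]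
    rintro x ⟨-, h1⟩ ⟨-, h2⟩
    omega
  congr 1
  rw [Set.Finite.ncard_eq_sum_fiber (finite_of_subset_gapPairs (n := n) (p := p) fun x h => h.1.1)
    (fun x => x.1 1) (Finset.Icc 1 p)]
  · refine Finset.sum_congr rfl fun v hv => ?_
    rw [Finset.mem_Icc] at hv
    split_ifs with hvn
    · symm
      refine Set.BijOn.ncard_eq
        (f := fun x => (splice (fun i => i * v) 1 x.1, splice (fun i => i * v) 1 x.2))
        (Set.InvOn.bijOn (f' := fun x => (gapTail 1 x.1, gapTail 1 x.2)) ⟨?_, ?_⟩ ?_ ?_)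
      · rintro ⟨P, Q⟩ ⟨⟨(hP : IsGapSeq p _ P), (hQ : IsGapSeq p _ Q), -⟩, -⟩
        exact congrArg₂ Prod.mk (gapTail_splice (fun i => i * v) 1 hP.zero)
          (gapTail_splice (fun i => i * v) 1 hQ.zero)
      · rintro ⟨P, Q⟩ ⟨⟨⟨⟨hP, hQ, -⟩, -⟩, h1⟩, rfl⟩
        simp only at h1 hP hQ ⊢
        refine congrArg₂ Prod.mk (splice_gapTail hP fun i hi => ?_) (splice_gapTail hQ fun i hi => ?_)
        · interval_cases i <;> simp [hP.zero]
        · interval_cases i <;> simp [hQ.zero, h1]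
      · rintro ⟨P, Q⟩ ⟨⟨hP, hQ, hPQ⟩, h2, h3⟩
        simp only at hP hQ hPQ h2 h3
        have hP' := IsGapSeq.splice_one hv.1 hv.2 hvn hP
        have hQ' := IsGapSeq.splice_one hv.1 hv.2 hvn hQ
        have e1 : splice (fun i => i * v) 1 P 1 = v := by simp [splice]
        have e2 : splice (fun i => i * v) 1 Q 1 = v := by simp [splice]
        refine ⟨⟨⟨⟨hP', hQ', ?_⟩, ?_, ?_⟩, e1.trans e2.symm⟩, e1⟩
        · intro i
          have : P (i - 1) ≤ Q (i - 1) := hPQ _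
          simp only [splice]; split_ifs <;> omega
        · rw [← aligned_gapTail_iff hP' hQ' (e1.trans e2.symm), gapTail_splice _ _ hP.zero,
            gapTail_splice _ _ hQ.zero]
          exact h2
        · rw [← gapHeight_gapTail hP' hQ' (e1.trans e2.symm), gapTail_splice _ _ hP.zero,
            gapTail_splice _ _ hQ.zero, e1]
          exact h3
      · rintro ⟨P, Q⟩ ⟨⟨⟨⟨hP, hQ, hPQ⟩, h2, h3⟩, h1⟩, rfl⟩
        simp only at hP hQ hPQ h1 h2 h3 ⊢
        refine ⟨⟨hP.gapTail 1, h1 ▸ hQ.gapTail 1, fun i => ?_⟩, (aligned_gapTail_iff hP hQ h1).2 h2,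
          (gapHeight_gapTail hP hQ h1).trans h3⟩
        have : P (1 + i) ≤ Q (1 + i) := hPQ _
        simp only [gapTail]; omega
    · rw [Set.ncard_eq_zero (finite_of_subset_gapPairs fun x h => h.1.1.1)]
      ext x
      simp only [Set.mem_empty_iff_false, iff_false]
      rintro ⟨⟨⟨⟨hP, -⟩, -⟩, -⟩, rfl⟩
      exact hvn (hP.le 1)
  · rintro x ⟨⟨⟨hP, -⟩, -⟩, -⟩
    have := hP.one_le hn
    have := hP.upper 0; have := hP.zero
    simp only [zero_add] at *
    rw [Finset.mem_Icc]; omega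

/-! ### Counting the active pairs, shape by shape. -/

/-- The sequence `Q` with its terms of indices `1, …, m` lowered by `d`. -/
def lowered (d m : ℕ) (Q : ℕ → ℕ) : ℕ → ℕ := fun i => if 1 ≤ i ∧ i ≤ m then Q i - d else Q i

/-- Exact steps `q ≥ 1` inside the block keep it from a plateau at `n`, which lowering would make
illegal. At the end of the block the increment grows by `d`, hence `hlast`. -/
theorem IsGapSeq.lowered {p n d q m : ℕ} {Q : ℕ → ℕ} (hQ : IsGapSeq p n Q) (hm : 1 ≤ m)
    (hd : d < Q 1) (hq : 1 ≤ q)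
    (hstep : ∀ i, 1 ≤ i → i < m → Q (i + 1) = Q i + q) (hlast : Q (m + 1) + d ≤ Q m + p) :
    IsGapSeq p n (lowered d m Q) := by
  have h1 : ∀ i, 1 ≤ i → d < Q i := fun i hi => hd.trans_le (hQ.mono hi)
  have hz := hQ.zero
  refine ⟨by simp [_root_.lowered, hz], fun i => ?_, fun i => ?_, fun i => ?_⟩
  · have := hQ.le i
    simp only [_root_.lowered]; split_ifs <;> omega
  · have := hQ.lower i
    rcases Nat.eq_zero_or_pos i with rfl | hi
    · simp only [_root_.lowered, zero_add, if_pos (And.intro le_rfl hm)] at *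
      simp; omega
    · have := h1 i hi
      have := h1 (i + 1) (by omega)
      have := hQ.le (i + 1)
      rcases lt_or_ge i m with him | him
      · have := hstep i hi him
        simp only [_root_.lowered]; split_ifs <;> omega
      · simp only [_root_.lowered]; split_ifs <;> omega
  · have := hQ.upper i
    rcases Nat.eq_zero_or_pos i with rfl | hi
    · simp only [_root_.lowered, zero_add, if_pos (And.intro le_rfl hm)] at *
      simp; omega
    · have := h1 i hi
      have := h1 (i + 1) (by omega)
      rcases lt_trichotomy i m with him | rfl | him
      · simp only [_root_.lowered]; split_ifs <;> omega
      · simp only [_root_.lowered]; split_ifs <;> omega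
      · simp only [_root_.lowered]; split_ifs <;> omega

/-- The free datum is the tail of `Q` after the block. Since `P` leaves the block from a value lower
by `d`, the first increment of that tail is at most `p - d`, as counted by `gapSeqCount p d`. -/
theorem ncard_stairPair {p n j d q m : ℕ} (hd : 1 ≤ d) (hdj : d < j) (hj : j ≤ p)
    (hq : 1 ≤ q) (hqp : q ≤ p) :
    {x | x ∈ GapPairs p n ∧ StairPair j d q (m + 1) x.1 x.2}.ncard =
      if j + m * q ≤ n then gapSeqCount p d (n - (j + m * q)) else 0 := by
  split_ifs with hn
  · symm
    set u : ℕ → ℕ := fun i => if i = 0 then 0 else j + (i - 1) * q with hu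
    have hum : u (m + 1) = j + m * q := by simp [hu]
    have hu1 : ∀ i, u (i + 1) = j + i * q := fun i => by simp [hu]
    have huu : ∀ i < m + 1, u i < u (i + 1) ∧ u (i + 1) ≤ u i + p := by
      intro i _
      rcases i with _ | i
      · simp [hu]; omega
      · rw [hu1, hu1, add_mul]; omega
    refine Set.BijOn.ncard_eq
      (f := fun r => (lowered d (m + 1) (splice u (m + 1) r), splice u (m + 1) r))
      (Set.InvOn.bijOn (f' := fun x => gapTail (m + 1) x.2) ⟨?_, ?_⟩ ?_ ?_)
    · exact fun r hr => gapTail_splice _ _ hr.1.zero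
    · rintro ⟨P, Q⟩ ⟨⟨(hP : IsGapSeq p n P), (hQ : IsGapSeq p n Q), -⟩, h⟩
      have e : splice u (m + 1) (gapTail (m + 1) Q) = Q := splice_gapTail hQ fun i hi => by
        rcases i with _ | i
        · simp [hu, hQ.zero]
        · rw [hu1]; exact (h.1 i (by omega)).2
      refine congrArg₂ Prod.mk ?_ e
      rw [e]
      funext i
      rcases i with _ | i
      · simp [lowered, hP.zero, hQ.zero]
      · by_cases hi : i < m + 1
        · have h1 : P (i + 1) + d = _ ∧ Q (i + 1) = _ := h.1 i hi
          rw [lowered, if_pos (by omega)]; omega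
        · have h1 : P (i + 1) = Q (i + 1) := h.2 i (by omega)
          rw [lowered, if_neg (by omega), h1]
    · rintro r ⟨hr, hr1⟩
      have hQ : IsGapSeq p n (splice u (m + 1) r) :=
        IsGapSeq.splice (by simp [hu]) huu (by rwa [hum]) (by rwa [hum])
      have hs : ∀ i < m + 1, splice u (m + 1) r (i + 1) = j + i * q := by
        intro i hi
        rw [splice, if_pos (by omega), hu1]
      have hP : IsGapSeq p n (lowered d (m + 1) (splice u (m + 1) r)) := by
        refine hQ.lowered (q := q) (by omega) ?_ hq ?_ ?_
        · have := hs 0 (by omega); simp only [zero_add, zero_mul] at this; omega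
        · intro i hi him
          obtain ⟨i, rfl⟩ := Nat.exists_eq_add_of_le' hi
          rw [hs _ (by omega), hs _ (by omega), add_mul]; ring
        · rw [splice_apply_add _ _ hr.zero, hs _ (by omega), hum]; omega
      refine ⟨⟨hP, hQ, fun i => ?_⟩, fun i hi => ?_, fun i hi => ?_⟩
      · simp only [lowered]; split_ifs <;> omega
      · have := hs i hi
        simp only
        rw [lowered, if_pos (by omega)]; omega
      · simp only
        rw [lowered, if_neg (by omega)]
    · rintro ⟨P, Q⟩ ⟨⟨(hP : IsGapSeq p n P), (hQ : IsGapSeq p n Q), -⟩, h⟩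
      have h1 : P (m + 1) + d = j + m * q ∧ Q (m + 1) = j + m * q := h.1 m (by omega)
      have h2 : P (m + 1 + 1) = Q (m + 1 + 1) := h.2 (m + 1) le_rfl
      refine ⟨h1.2 ▸ hQ.gapTail (m + 1), ?_⟩
      have := hP.upper (m + 1)
      simp only [gapTail]
      omega
  · rw [Set.ncard_eq_zero (finite_of_subset_gapPairs fun x h => h.1)]
    ext x
    simp only [Set.mem_empty_iff_false, iff_false]
    rintro ⟨⟨-, hQ, -⟩, h⟩
    have := hQ.le (m + 1); have := (h.1 m (by omega)).2
    omega

/-- The number of linear intervals of height `k` whose bounds differ by one at `k` consecutive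
indices, starting with the first, and follow steps of size `q` there. -/
noncomputable def stairCount (p q n k : ℕ) : ℕ :=
  if k = 0 then 0 else ∑ j ∈ Finset.Icc 2 p,
    if j + (k - 1) * q ≤ n then gapSeqCount p 1 (n - (j + (k - 1) * q)) else 0

theorem ncard_unit_stairPairs {p q n k : ℕ} (hq : 1 ≤ q) (hqp : q ≤ p) (hk : 1 ≤ k) :
    {x | x ∈ GapPairs p n ∧ StairPair (x.2 1) 1 q k x.1 x.2}.ncard = stairCount p q n k := by
  obtain ⟨k, rfl⟩ := Nat.exists_eq_add_of_le' hk
  rw [stairCount, if_neg (by omega), Set.Finite.ncard_eq_sum_fiber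
    (finite_of_subset_gapPairs fun x h => h.1) (fun x => x.2 1) (Finset.Icc 2 p)]
  · refine Finset.sum_congr rfl fun j hj => ?_
    rw [Finset.mem_Icc] at hj
    rw [Nat.add_sub_cancel, ← ncard_stairPair le_rfl (by omega) hj.2 hq hqp]
    congr 1
    ext x
    constructor
    · rintro ⟨⟨h1, h2⟩, rfl⟩; exact ⟨h1, h2⟩
    · rintro ⟨h1, h2⟩
      have : x.2 1 = j := by simpa using (h2.1 0 (by omega)).2
      exact ⟨⟨h1, this.symm ▸ h2⟩, this⟩
  · rintro ⟨P, Q⟩ ⟨⟨(hP : IsGapSeq p n P), (hQ : IsGapSeq p n Q), -⟩, h⟩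
    have h1 := (h.1 0 (by omega)).1
    have h2 := hQ.upper 0
    have h3 := hQ.le 1
    simp only [zero_add, zero_mul, add_zero, hQ.zero] at h1 h2
    have := hP.one_le (by omega)
    change Q 1 ∈ Finset.Icc 2 p
    rw [Finset.mem_Icc]; omega

theorem ncard_single_stairPairs {p n k : ℕ} (hp : 1 ≤ p) :
    {x | x ∈ GapPairs p n ∧ 2 ≤ k ∧ x.1 1 + k = x.2 1 ∧ StairPair (x.2 1) k 1 1 x.1 x.2}.ncard =
      ∑ i ∈ Finset.Icc 1 p, ∑ j ∈ Finset.Icc 1 p with i + 2 ≤ j,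
        if j - i = k ∧ j ≤ n then gapSeqCount p k (n - j) else 0 := by
  rw [Set.Finite.ncard_eq_sum_fiber (finite_of_subset_gapPairs fun x h => h.1) (fun x => x.1 1)
    (Finset.Icc 1 p)]
  · refine Finset.sum_congr rfl fun i hi => ?_
    rw [Finset.mem_Icc] at hi
    rw [Set.Finite.ncard_eq_sum_fiber (finite_of_subset_gapPairs fun x h => h.1.1) (fun x => x.2 1)
      ((Finset.Icc 1 p).filter (i + 2 ≤ ·))]
    · refine Finset.sum_congr rfl fun j hj => ?_
      rw [Finset.mem_filter, Finset.mem_Icc] at hj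
      by_cases hk : j - i = k
      · simp only [hk, true_and]
        have := ncard_stairPair (p := p) (n := n) (j := j) (d := k) (q := 1) (m := 0) (by omega)
          (by omega) hj.1.2 le_rfl hp
        simp only [zero_mul, add_zero, zero_add] at this
        rw [← this]
        congr 1
        ext x
        constructor
        · rintro ⟨⟨⟨h1, h2, h3, h4⟩, h5⟩, rfl⟩; exact ⟨h1, h4⟩
        · rintro ⟨h1, h4⟩
          have h5 := h4.1 0 (by omega)
          simp only [zero_add, zero_mul, add_zero] at h5
          exact ⟨⟨⟨h1, by omega, by omega, h5.2.symm ▸ h4⟩, by omega⟩, h5.2⟩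
      · rw [if_neg (by tauto), Set.ncard_eq_zero (finite_of_subset_gapPairs fun x h => h.1.1.1)]
        ext x
        simp only [Set.mem_empty_iff_false, iff_false]
        rintro ⟨⟨⟨h1, h2, h3, h4⟩, h5⟩, h6⟩
        omega
    · rintro ⟨P, Q⟩ ⟨⟨⟨hP, (hQ : IsGapSeq p n Q), -⟩, h2, h3, h4⟩, h5⟩
      have := hQ.upper 0; have := hQ.zero
      simp only [zero_add] at *
      rw [Finset.mem_filter, Finset.mem_Icc]; omega
  · rintro ⟨P, Q⟩ ⟨⟨(hP : IsGapSeq p n P), (hQ : IsGapSeq p n Q), -⟩, h2, h3, h4⟩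
    have := hP.upper 0; have := hP.zero; have := hQ.le 1
    have h3 : P 1 + k = Q 1 := h3
    have := hP.one_le (by omega)
    simp only [zero_add] at *
    rw [Finset.mem_Icc]; omega

theorem ncard_exceptionalPairs (p n : ℕ) :
    {x | x ∈ GapPairs p n ∧ x.1 1 + 2 = n ∧ x.2 1 = n ∧ x.1 2 + 1 = n}.ncard =
      if 3 ≤ n ∧ n ≤ p then 1 else 0 := by
  split_ifs with h
  · rw [Set.ncard_eq_one]
    obtain ⟨A, hA⟩ : ∃ A : ℕ → ℕ, ∀ i, A i =
        if i = 0 then 0 else if i = 1 then n - 2 else if i = 2 then n - 1 else n :=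
      ⟨_, fun _ => rfl⟩
    obtain ⟨B, hB⟩ : ∃ B : ℕ → ℕ, ∀ i, B i = if i = 0 then 0 else n := ⟨_, fun _ => rfl⟩
    have hlow : IsGapSeq p n A := by
      refine ⟨hA 0, fun i => ?_, fun i => ?_, fun i => ?_⟩ <;> simp only [hA] <;> split_ifs <;>
        first | contradiction | omega
    have hhigh : IsGapSeq p n B := by
      refine ⟨hB 0, fun i => ?_, fun i => ?_, fun i => ?_⟩ <;> simp only [hB] <;> split_ifs <;>
        first | contradiction | omega
    -- The conditions leave only `(0, n - 2, n - 1, n, …)` below `(0, n, n, …)`. A positive first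
    -- term of the lower one needs `n ≥ 3`, and the first step of the upper one needs `n ≤ p`.
    refine ⟨(A, B), Set.eq_singleton_iff_unique_mem.2 ⟨⟨⟨hlow, hhigh, fun i => ?_⟩, ?_, ?_, ?_⟩, ?_⟩⟩
    · simp only [hA, hB]; split_ifs <;> omega
    · simp [hA]; omega
    · simp [hB]
    · simp [hA]; omega
    · rintro ⟨P, Q⟩ ⟨⟨(hP : IsGapSeq p n P), (hQ : IsGapSeq p n Q), -⟩, h1, h2, h3⟩
      simp only at h1 h2 h3
      have h4 := hP.lower 2
      simp only [Nat.reduceAdd] at h4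
      refine congrArg₂ Prod.mk (funext fun i => ?_) (funext fun i => ?_)
      · rw [hA]
        split_ifs with a b c
        · rw [a, hP.zero]
        · subst b; omega
        · subst c; omega
        · have := hP.mono (show 3 ≤ i by omega)
          have := hP.le i; omega
      · rw [hB]
        split_ifs with a
        · rw [a, hQ.zero]
        · have := hQ.mono (show 1 ≤ i by omega)
          have := hQ.le i; omega
  · rw [Set.ncard_eq_zero (finite_of_subset_gapPairs fun x h => h.1)]
    ext x
    simp only [Set.mem_empty_iff_false, iff_false]
    rintro ⟨⟨hP, hQ, -⟩, h1, h2, h3⟩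
    have := hP.one_le (by omega)
    have := hQ.upper 0; have := hQ.zero
    simp only [zero_add] at *
    omega

theorem activePairs_of_height_zero (p n : ℕ) : ActivePairs p n 0 = ∅ := by
  ext x
  simp only [Set.mem_empty_iff_false, iff_false]
  rintro ⟨⟨⟨hP, hQ, hPQ⟩, -, h⟩, h1⟩
  have := gapHeight_pos hP hQ (lt_of_le_of_ne hPQ fun hc => by rw [hc] at h1; omega)
  omega

theorem mem_activePairs_iff {p n k : ℕ} (hp : 3 ≤ p) {x : (ℕ → ℕ) × (ℕ → ℕ)}
    (hx : x ∈ GapPairs p n) : x ∈ ActivePairs p n k ↔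
      (1 ≤ k ∧ x.1 1 + k = x.2 1 ∧ StairPair (x.2 1) k 1 1 x.1 x.2) ∨
      (2 ≤ k ∧ StairPair (x.2 1) 1 p k x.1 x.2) ∨ (2 ≤ k ∧ StairPair (x.2 1) 1 1 k x.1 x.2) ∨
      (k = 3 ∧ x.1 1 + 2 = n ∧ x.2 1 = n ∧ x.1 2 + 1 = n) := by
  obtain ⟨P, Q⟩ := x
  obtain ⟨(hP : IsGapSeq p n P), (hQ : IsGapSeq p n Q), (hPQ : P ≤ Q)⟩ := hx
  simp only
  constructor
  · rintro ⟨⟨-, (h2 : Aligned p P Q), (h3 : gapHeight n P Q = k)⟩, (h1 : P 1 < Q 1)⟩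
    rcases (aligned_iff hp hP hQ hPQ h1).1 h2 with h | ⟨m, hm, h⟩ | ⟨m, hm, h⟩ | h
    · have := h.gapHeight hP hQ (by omega)
      rw [h3, one_mul] at this
      rw [← this] at h
      exact Or.inl ⟨by omega, by omega, h⟩
    · have := h.gapHeight hP hQ one_pos
      rw [h3, mul_one] at this
      subst this
      exact Or.inr (Or.inl ⟨hm, h⟩)
    · have := h.gapHeight hP hQ one_pos
      rw [h3, mul_one] at this
      subst this
      exact Or.inr (Or.inr (Or.inl ⟨hm, h⟩))
    · exact Or.inr (Or.inr (Or.inr ⟨h3.symm.trans (gapHeight_eq_three hP hQ h), h⟩))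
  · have build : P 1 < Q 1 → Aligned p P Q → gapHeight n P Q = k → (P, Q) ∈ ActivePairs p n k :=
      fun a b c => ⟨⟨⟨hP, hQ, hPQ⟩, b, c⟩, a⟩
    rintro (⟨h1, h2, h⟩ | ⟨h1, h⟩ | ⟨h1, h⟩ | ⟨h1, h⟩)
    · exact build (by omega) (h.aligned hP hQ (Or.inl rfl))
        ((h.gapHeight hP hQ (by omega)).trans (one_mul k))
    · have h2 := h.1 0 (by omega)
      simp only [zero_add] at h2
      exact build (by omega) (h.aligned hP hQ (Or.inr ⟨rfl, Or.inr rfl⟩))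
        ((h.gapHeight hP hQ one_pos).trans (mul_one k))
    · have h2 := h.1 0 (by omega)
      simp only [zero_add] at h2
      exact build (by omega) (h.aligned hP hQ (Or.inr ⟨rfl, Or.inl rfl⟩))
        ((h.gapHeight hP hQ one_pos).trans (mul_one k))
    · exact build (by omega) ((aligned_iff hp hP hQ hPQ (by omega)).2 (Or.inr (Or.inr (Or.inr h))))
        ((gapHeight_eq_three hP hQ h).trans h1.symm)

/-- At height one the single difference and both staircases are the same shape, counted twice on the
right; the extra term on the left compensates. For `k ≥ 2` the shapes are disjoint, as the terms of
index `1` and `2` show. -/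
theorem ncard_activePairs {p : ℕ} (hp : 3 ≤ p) (n k : ℕ) :
    (ActivePairs p n k).ncard + (if k = 1 then stairCount p 1 n 1 else 0) =
      (∑ i ∈ Finset.Icc 1 p, ∑ j ∈ Finset.Icc 1 p with i + 2 ≤ j,
        if j - i = k ∧ j ≤ n then gapSeqCount p k (n - j) else 0) +
      stairCount p p n k + stairCount p 1 n k + (if k = 3 ∧ 3 ≤ n ∧ n ≤ p then 1 else 0) := by
  have hV := ncard_single_stairPairs (p := p) (n := n) (k := k) (by omega)
  rcases Nat.eq_zero_or_pos k with rfl | hk0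
  · rw [activePairs_of_height_zero, ← hV]
    simp [stairCount]
  by_cases hk1 : k = 1
  · subst hk1
    have h1 : ActivePairs p n 1 =
        {x | x ∈ GapPairs p n ∧ StairPair (x.2 1) 1 1 1 x.1 x.2} := by
      ext x
      constructor
      · intro h
        refine ⟨h.1.1, ?_⟩
        rcases (mem_activePairs_iff hp h.1.1).1 h with h | h | h | h
        · exact h.2.2
        all_goals omega
      · rintro ⟨h1, h2⟩
        refine (mem_activePairs_iff hp h1).2 (Or.inl ⟨le_rfl, ?_, h2⟩)
        simpa using (h2.1 0 one_pos).1
    rw [h1, ncard_unit_stairPairs le_rfl (by omega) le_rfl, ← hV]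
    simp [stairCount]
  have hk : 2 ≤ k := by omega
  have hE : {x | x ∈ GapPairs p n ∧ k = 3 ∧ x.1 1 + 2 = n ∧ x.2 1 = n ∧ x.1 2 + 1 = n}.ncard =
      if k = 3 ∧ 3 ≤ n ∧ n ≤ p then 1 else 0 := by
    by_cases h3 : k = 3
    · simp only [h3, true_and]
      exact ncard_exceptionalPairs p n
    · simp [h3]
  rw [if_neg hk1, add_zero, ← hV, ← hE, ← ncard_unit_stairPairs (by omega) le_rfl hk0,
    ← ncard_unit_stairPairs le_rfl (by omega) hk0]
  rw [← Set.ncard_union_eq ?_ (finite_of_subset_gapPairs fun x h => h.1)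
    (finite_of_subset_gapPairs fun x h => h.1), ← Set.ncard_union_eq ?_
    (finite_of_subset_gapPairs (n := n) (p := p) ?_)
    (finite_of_subset_gapPairs fun x h => h.1), ← Set.ncard_union_eq ?_
    (finite_of_subset_gapPairs (n := n) (p := p) ?_)
    (finite_of_subset_gapPairs fun x h => h.1)]
  · congr 1
    ext x
    constructor
    · intro h
      rcases (mem_activePairs_iff hp h.1.1).1 h with h' | h' | h' | h'
      · exact Or.inl (Or.inl (Or.inl ⟨h.1.1, hk, h'.2⟩))
      · exact Or.inl (Or.inl (Or.inr ⟨h.1.1, h'.2⟩))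
      · exact Or.inl (Or.inr ⟨h.1.1, h'.2⟩)
      · exact Or.inr ⟨h.1.1, h'⟩
    · rintro (((h | h) | h) | h)
      · exact (mem_activePairs_iff hp h.1).2 (Or.inl ⟨by omega, h.2.2⟩)
      · exact (mem_activePairs_iff hp h.1).2 (Or.inr (Or.inl ⟨hk, h.2⟩))
      · exact (mem_activePairs_iff hp h.1).2 (Or.inr (Or.inr (Or.inl ⟨hk, h.2⟩)))
      · exact (mem_activePairs_iff hp h.1).2 (Or.inr (Or.inr (Or.inr h.2)))
  · rw [Set.disjoint_left]
    rintro x ((h | h) | h) ⟨⟨hP, hQ, -⟩, h2⟩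
    · have : x.1 2 = x.2 2 := h.2.2.2.2 1 le_rfl
      have := hQ.mono one_le_two
      have := hQ.le 2
      omega
    · have := h.2.1 0 (by omega)
      simp only [zero_add] at this
      omega
    · have := h.2.1 0 (by omega)
      simp only [zero_add] at this
      omega
  · rintro x ((h | h) | h) <;> exact h.1
  · rw [Set.disjoint_left]
    rintro x (h | h) ⟨-, h2⟩
    · have := h.2.2.2.2 1 le_rfl
      have := h2.1 1 (by omega)
      omega
    · have := h.2.1 1 (by omega)
      have := h2.1 1 (by omega)
      omega
  · rintro x (h | h) <;> exact h.1
  · rw [Set.disjoint_left]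
    rintro x h ⟨-, h2⟩
    have := h.2.2.2.2 1 le_rfl
    have := h2.1 1 (by omega)
    omega

/-! ### Dyck paths as gap sequences. -/

open DyckStep in
/-- The word `D^{g₁} U D^{g₂} U ⋯` with the given exponents. -/
def blockWord (gs : List ℕ) : List DyckStep := gs.flatMap fun g => List.replicate g D ++ [U]

namespace blockWord

open DyckStep

theorem cons (g : ℕ) (gs : List ℕ) :
    blockWord (g :: gs) = List.replicate g D ++ U :: blockWord gs := by
  simp [blockWord]

theorem append (gs hs : List ℕ) : blockWord (gs ++ hs) = blockWord gs ++ blockWord hs := by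
  simp [blockWord]

theorem count_U (gs : List ℕ) : (blockWord gs).count U = gs.length := by
  induction gs with
  | nil => rfl
  | cons g gs ih => rw [cons]; simp [List.count_append, List.count_replicate, ih]

theorem count_D (gs : List ℕ) : (blockWord gs).count D = gs.sum := by
  induction gs with
  | nil => rfl
  | cons g gs ih => rw [cons]; simp [List.count_append, ih]

theorem exists_eq (r : List DyckStep) (h : r = [] ∨ r.getLast? = some U) :
    ∃ gs, r = blockWord gs := by
  induction r with
  | nil => exact ⟨[], rfl⟩
  | cons a r ih =>
    rcases r with _ | ⟨b, r⟩
    · simp at h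
      exact ⟨[0], by simp [blockWord, h]⟩
    · simp only [reduceCtorEq, false_or, List.getLast?_cons_cons] at h
      obtain ⟨gs, hgs⟩ := ih (Or.inr h)
      rw [hgs]
      cases a with
      | U => exact ⟨0 :: gs, by simp [cons]⟩
      | D =>
        rcases gs with _ | ⟨g, gs⟩
        · simp [blockWord] at hgs
        · exact ⟨(g + 1) :: gs, by simp [cons, List.replicate_succ]⟩

theorem prefix_bounds (gs : List ℕ) : ∀ a, a <+: blockWord gs →
    (gs.take (a.count U)).sum ≤ a.count D ∧ a.count D ≤ (gs.take (a.count U + 1)).sum := by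
  induction gs with
  | nil =>
    intro a ha
    have : a = [] := by simpa [blockWord] using ha
    subst this; simp
  | cons g gs ih =>
    intro a ha
    rw [cons] at ha
    obtain ⟨t, ht⟩ := ha
    rcases List.append_eq_append_iff.1 ht with ⟨c, h, -⟩ | ⟨b, rfl, hb⟩
    · replace h : a <+: List.replicate g D := ⟨c, h.symm⟩
      obtain ⟨m, hm, rfl⟩ : ∃ m, m ≤ g ∧ a = List.replicate m D := by
        rw [List.prefix_replicate_iff] at h
        exact ⟨a.length, h⟩
      simp [List.count_replicate, hm]
    · rcases b with _ | ⟨c, b⟩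
      · simp [List.count_replicate]
      · rw [List.cons_append, List.cons.injEq] at hb
        obtain ⟨rfl, hb⟩ := hb
        have := ih b ⟨t, hb.symm⟩
        simp [List.count_append, List.count_replicate] at this ⊢
        omega

end blockWord

theorem List.sum_take_add_one (gs : List ℕ) (i : ℕ) :
    (gs.take (i + 1)).sum = (gs.take i).sum + gs.getD i 0 := by
  by_cases h : i < gs.length
  · rw [List.sum_take_succ _ _ h]; simp [h]
  · rw [List.take_of_length_le (by omega), List.take_of_length_le (by omega)]
    simp [not_lt.1 h]

/-- The word `l` has `s i` down steps after its `i`-th last up step. -/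
def HasGaps (l : List DyckStep) (s : ℕ → ℕ) : Prop :=
  ∃ gs, l.reverse = blockWord gs ∧ ∀ i, s i = (gs.take i).sum

namespace HasGaps

open DyckStep

variable {l : List DyckStep} {s : ℕ → ℕ}

/-- A suffix with `u` up steps starts somewhere between the `(u + 1)`-th last and the `u`-th last up
step. These bounds carry the dictionary between paths and sequences; `exists_drop` says that the
upper one is attained. -/
theorem drop_bounds (h : HasGaps l s) (k : ℕ) :
    s ((l.drop k).count U) ≤ (l.drop k).count D ∧
      (l.drop k).count D ≤ s ((l.drop k).count U + 1) := by
  obtain ⟨gs, h1, h2⟩ := h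
  have h3 : (l.drop k).reverse <+: blockWord gs := by
    rw [← h1, List.reverse_prefix]; exact List.drop_suffix k l
  have := blockWord.prefix_bounds gs _ h3
  rw [h2, h2]
  simpa [List.count_reverse] using this

theorem suffix_bounds (h : HasGaps l s) {a : List DyckStep} (ha : a <:+ l) :
    s (a.count U) ≤ a.count D ∧ a.count D ≤ s (a.count U + 1) := by
  rw [List.suffix_iff_eq_drop] at ha
  rw [ha]; exact h.drop_bounds _

theorem exists_drop (h : HasGaps l s) {i : ℕ} (hi : i < l.count U) :
    ∃ k, (l.drop k).count U = i ∧ (l.drop k).count D = s (i + 1) := by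
  obtain ⟨gs, h1, h2⟩ := h
  have hlen : i < gs.length := by
    rwa [← blockWord.count_U, ← h1, List.count_reverse]
  set b := blockWord (gs.take i) ++ List.replicate gs[i] D with hb
  have h3 : b <+: l.reverse := by
    rw [h1]
    conv_rhs => rw [← List.take_append_drop i gs, List.drop_eq_getElem_cons hlen, blockWord.append,
      blockWord.cons, ← List.append_assoc]
    exact List.prefix_append _ _
  have h4 : b.reverse <:+ l := by rw [← List.reverse_prefix]; simpa using h3
  rw [List.suffix_iff_eq_drop] at h4
  refine ⟨l.length - b.reverse.length, ?_, ?_⟩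
  · rw [← h4, List.count_reverse, hb, List.count_append, blockWord.count_U]
    simp [List.count_replicate]; omega
  · rw [← h4, List.count_reverse, hb, List.count_append, blockWord.count_D, h2,
      List.sum_take_add_one]
    simp [hlen]

theorem not_isInfix_replicate {p n : ℕ} (h : HasGaps l s) (hs : IsGapSeq p n s) :
    ¬ List.replicate (p + 1) D <:+: l := by
  rintro ⟨a, b, rfl⟩
  have h1 := h.suffix_bounds (a := b) (List.suffix_append _ _)
  have h2 := h.suffix_bounds (a := List.replicate (p + 1) D ++ b)
    ⟨a, by simp⟩
  have h3 := hs.upper (b.count U)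
  simp [List.count_append, List.count_replicate] at h2
  omega

/-- The two up steps add no down step, so the sequence would have to be stationary before reaching
`n`, although the preceding `D` shows that `n` has not been reached. -/
theorem not_isInfix_DUU {p n : ℕ} (h : HasGaps l s) (hs : IsGapSeq p n s) (hl : l.count D = n) :
    ¬ [D, U, U] <:+: l := by
  rintro ⟨a, b, rfl⟩
  have h1 := h.suffix_bounds (a := b) ⟨a ++ [D, U, U], by simp⟩
  have h2 := h.suffix_bounds (a := U :: U :: b) ⟨a ++ [D], by simp⟩
  have h3 := hs.lower (b.count U + 1)
  simp [List.count_append] at h2 hl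
  omega

end HasGaps

theorem FibPath.count_U {p n : ℕ} (P : FibPath p n) : P.path.toList.count DyckStep.U = n :=
  P.semilength_eq

theorem FibPath.count_D {p n : ℕ} (P : FibPath p n) : P.path.toList.count DyckStep.D = n := by
  rw [← P.path.count_U_eq_count_D]; exact P.semilength_eq

theorem FibPath.pathOrdinate_eq {p n : ℕ} (P : FibPath p n) (k : ℕ) :
    pathOrdinate P.path k = ((P.path.toList.drop k).count DyckStep.D : ℤ) -
      ((P.path.toList.drop k).count DyckStep.U : ℤ) := by
  have h1 := P.count_U
  have h2 := P.count_D
  rw [← List.take_append_drop k P.path.toList, List.count_append] at h1 h2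
  unfold pathOrdinate
  omega

theorem FibPath.length_toList {p n : ℕ} (P : FibPath p n) : P.path.toList.length = 2 * n := by
  rw [← P.path.two_mul_semilength_eq_length, P.semilength_eq]

theorem List.count_U_add_count_D (l : List DyckStep) :
    l.count DyckStep.U + l.count DyckStep.D = l.length := by
  induction l with
  | nil => rfl
  | cons a l ih => cases a <;> simp <;> omega

/-- The ordinate is the number of downs minus ups in the remaining suffix. As suffixes at the same
position have equal length, the higher path has more downs and fewer ups there. -/
theorem FibPath.le_iff_of_hasGaps {p n : ℕ} {P Q : FibPath p n} {s t : ℕ → ℕ}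
    (hP : HasGaps P.path.toList s) (hQ : HasGaps Q.path.toList t) (hs : IsGapSeq p n s)
    (ht : IsGapSeq p n t) : P ≤ Q ↔ s ≤ t := by
  have hlen : ∀ k, (P.path.toList.drop k).count DyckStep.U +
      (P.path.toList.drop k).count DyckStep.D = (Q.path.toList.drop k).count DyckStep.U +
      (Q.path.toList.drop k).count DyckStep.D := by
    intro k
    rw [List.count_U_add_count_D, List.count_U_add_count_D, List.length_drop, List.length_drop,
      P.length_toList, Q.length_toList]
  constructor
  · intro h i
    by_cases hi : n < i
    · rw [hs.eq_top hi.le, ht.eq_top hi.le]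
    rcases i with _ | i
    · rw [hs.zero]; exact Nat.zero_le _
    obtain ⟨k, h1, h2⟩ := hP.exists_drop (i := i) (by rw [P.count_U]; omega)
    have h3 := h k
    rw [P.pathOrdinate_eq, Q.pathOrdinate_eq] at h3
    have h4 := hlen k
    have h5 := hQ.drop_bounds k
    have h6 := ht.mono (show (Q.path.toList.drop k).count DyckStep.U + 1 ≤ i + 1 by omega)
    change s (i + 1) ≤ t (i + 1)
    omega
  · intro h k
    rw [P.pathOrdinate_eq, Q.pathOrdinate_eq]
    have h4 := hlen k
    have h5 := hP.drop_bounds k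
    have h6 := hQ.drop_bounds k
    by_contra hc
    have h7 := ht.mono (show (P.path.toList.drop k).count DyckStep.U + 1 ≤
      (Q.path.toList.drop k).count DyckStep.U by omega)
    have h8 : s _ ≤ t _ := h ((P.path.toList.drop k).count DyckStep.U + 1)
    omega

theorem FibPath.exists_hasGaps {p n : ℕ} (P : FibPath p n) :
    ∃ s, IsGapSeq p n s ∧ HasGaps P.path.toList s := by
  obtain ⟨gs, hgs⟩ := blockWord.exists_eq P.path.toList.reverse (by
    by_cases h : P.path.toList = []
    · simp [h]
    · right
      have hne : P.path ≠ 0 := by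
        intro hc; apply h; rw [hc]; rfl
      rw [List.getLast?_reverse, List.head?_eq_some_head h]
      congr 1
      exact P.path.head_eq_U h)
  have hlen : gs.length = n := by
    rw [← blockWord.count_U, ← hgs, List.count_reverse, P.count_U]
  have hsum : gs.sum = n := by
    rw [← blockWord.count_D, ← hgs, List.count_reverse, P.count_D]
  have hsucc := List.sum_take_add_one gs
  have htop : ∀ i, n ≤ i → (gs.take i).sum = n := fun i hi => by
    rw [List.take_of_length_le (by omega), hsum]
  have hgp : ∀ i, gs.getD i 0 ≤ p := by
    intro i
    by_cases hi : i < gs.length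
    · by_contra hc
      apply P.avoids_D
      rw [← List.reverse_infix, hgs, List.reverse_replicate]
      obtain ⟨e, he⟩ := Nat.exists_eq_add_of_lt (not_le.1 hc)
      rw [← List.take_append_drop i gs, List.drop_eq_getElem_cons hi, blockWord.append,
        blockWord.cons]
      have : gs[i] = p + 1 + e := by simp [hi] at he; omega
      rw [this, List.replicate_add (p + 1) e]
      exact ⟨blockWord (gs.take i), List.replicate e DyckStep.D ++
        DyckStep.U :: blockWord (gs.drop (i + 1)), by simp only [List.append_assoc]⟩
    · simp [not_lt.1 hi]
  -- A zero gap followed by a nonzero one reads `UUD` in the reversed word, that is `DUU` in the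
  -- path.
  have hzero : ∀ i, i + 1 < n → gs.getD (i + 1) 0 = 0 → gs.getD (i + 1 + 1) 0 = 0 := by
    intro i hi h0
    by_contra h1
    have hi2 : i + 1 + 1 < gs.length := by
      by_contra hc; simp [not_lt.1 hc] at h1
    apply P.avoids_DUU
    rw [← List.reverse_infix, hgs]
    obtain ⟨e, he⟩ := Nat.exists_eq_succ_of_ne_zero h1
    rw [← List.take_append_drop i gs, List.drop_eq_getElem_cons (by omega),
      List.drop_eq_getElem_cons (by omega), List.drop_eq_getElem_cons hi2, blockWord.append,
      blockWord.cons, blockWord.cons, blockWord.cons]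
    have e1 : gs[i + 1] = 0 := by simpa [hlen, hi] using h0
    have e2 : gs[i + 1 + 1] = e + 1 := by simpa [hi2] using he
    rw [e1, e2, List.replicate_succ]
    exact ⟨blockWord (gs.take i) ++ List.replicate gs[i] DyckStep.D,
      List.replicate e DyckStep.D ++ DyckStep.U :: blockWord (gs.drop (i + 1 + 1 + 1)), by simp⟩
  have hle : ∀ i, (gs.take i).sum ≤ n := by
    intro i
    calc (gs.take i).sum ≤ (gs.take i).sum + (gs.drop i).sum := Nat.le_add_right _ _
      _ = n := by rw [← List.sum_append, List.take_append_drop, hsum]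
  refine ⟨fun i => (gs.take i).sum, ⟨by simp, hle, fun i => ?_, fun i => ?_⟩, gs, hgs, fun _ => rfl⟩
  · have h1 := hsucc i
    by_cases hg : gs.getD i 0 = 0
    swap
    · omega
    by_cases hi : n ≤ i
    · rw [htop i hi, htop (i + 1) (by omega)]; omega
    rcases i with _ | i
    · exfalso
      rcases gs with _ | ⟨g, gs⟩
      · simp at hlen; omega
      · simp at hg
        subst hg
        have hl : P.path.toList = (blockWord gs).reverse ++ [DyckStep.U] := by
          rw [← List.reverse_reverse P.path.toList, hgs, blockWord.cons]; simp
        have hne : P.path.toList ≠ [] := by simp [hl]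
        have := P.path.getLast_eq_D hne
        simp [hl] at this
    -- The zero gap propagates to the end of the word, so the partial sum is already the total `n`.
    · have hz : ∀ d, gs.getD (i + 1 + d) 0 = 0 := by
        intro d
        induction d with
        | zero => exact hg
        | succ d ih =>
          by_cases hd : i + d + 1 < n
          · have := hzero (i + d) hd (by rwa [show i + d + 1 = i + 1 + d by ring])
            rwa [show i + 1 + (d + 1) = i + d + 1 + 1 by ring]
          · rw [List.getD_eq_default]; omega
      have hc : ∀ d, (gs.take (i + 1 + d)).sum = (gs.take (i + 1)).sum := by
        intro d
        induction d with
        | zero => rfl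
        | succ d ih =>
          have := hsucc (i + 1 + d)
          rw [← add_assoc, this, ih, hz d, add_zero]
      have := hc (n - (i + 1))
      rw [htop _ (by omega)] at this
      omega
  · have := hsucc i; have := hgp i
    omega

theorem exists_list_hasGaps {p n : ℕ} {s : ℕ → ℕ} (hs : IsGapSeq p n s) :
    ∃ l, HasGaps l s ∧ l.count DyckStep.U = n ∧ l.count DyckStep.D = n := by
  set gs := (List.range n).map fun i => s (i + 1) - s i with hgs
  have hsum : ∀ i, s i = (gs.take i).sum := by
    intro i
    induction i with
    | zero => simp [hs.zero]
    | succ i ih =>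
      rw [List.sum_take_add_one, ← ih]
      have := hs.le_succ i
      by_cases hi : i < n
      · have : gs.getD i 0 = s (i + 1) - s i := by simp [hgs, hi]
        omega
      · rw [List.getD_eq_default _ _ (by simp [hgs]; omega), hs.eq_top (not_lt.1 hi),
          hs.eq_top (by omega)]
        rfl
  refine ⟨(blockWord gs).reverse, ⟨gs, by simp, hsum⟩, ?_, ?_⟩
  · rw [List.count_reverse, blockWord.count_U]; simp [hgs]
  · rw [List.count_reverse, blockWord.count_D, ← hs.eq_top le_rfl, hsum n,
      List.take_of_length_le (by simp [hgs])]

theorem FibPath.exists_of_isGapSeq {p n : ℕ} {s : ℕ → ℕ} (hs : IsGapSeq p n s) :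
    ∃ P : FibPath p n, HasGaps P.path.toList s := by
  obtain ⟨l, hl, hU, hD⟩ := exists_list_hasGaps hs
  refine ⟨⟨⟨l, hU.trans hD.symm, fun k => ?_⟩, hU, hl.not_isInfix_DUU hs hD,
    hl.not_isInfix_replicate hs⟩, hl⟩
  have h1 := hl.drop_bounds k
  rw [← List.take_append_drop k l, List.count_append] at hU hD
  -- Every suffix has at least as many downs as ups, which is the Dyck condition on the
  -- complementary prefix.
  have h2 := hs.min_le ((l.drop k).count DyckStep.U)
  omega

/-- The poset of paths is isomorphic to the poset of gap sequences. -/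
theorem nonempty_gapSeq_orderIso_fibPath (p n : ℕ) : Nonempty (GapSeq p n ≃o FibPath p n) := by
  choose f hf using fun s : GapSeq p n => FibPath.exists_of_isGapSeq s.2
  have hle : ∀ s t, f s ≤ f t ↔ s ≤ t := fun s t =>
    FibPath.le_iff_of_hasGaps (hf s) (hf t) s.2 t.2
  refine ⟨RelIso.ofSurjective (OrderEmbedding.ofMapLEIff f hle) fun P => ?_⟩
  obtain ⟨s, hs, hP⟩ := P.exists_hasGaps
  refine ⟨⟨s, hs⟩, ?_⟩
  exact le_antisymm ((FibPath.le_iff_of_hasGaps (hf _) hP hs hs).2 le_rfl)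
    ((FibPath.le_iff_of_hasGaps hP (hf _) hs hs).2 le_rfl)

theorem isLinearInterval_iff {p n : ℕ} (hp : 1 ≤ p) (e : GapSeq p n ≃o FibPath p n)
    {P Q : GapSeq p n} (h : P ≤ Q) :
    IsLinearInterval ⟨(e P, e Q), e.monotone h⟩ ↔ Aligned p P Q := by
  constructor
  · intro hl
    refine aligned_of_linear hp P.2 Q.2 h fun R S hR hS h1 h2 h3 h4 => ?_
    have := hl (e ⟨R, hR⟩) ⟨e.monotone h1, e.monotone h2⟩ (e ⟨S, hS⟩) ⟨e.monotone h3, e.monotone h4⟩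
    rwa [e.le_iff_le, e.le_iff_le] at this
  · rintro ha R ⟨hR1, hR2⟩ S ⟨hS1, hS2⟩
    have := linear_of_aligned ha (e.symm R).2 (e.symm S).2 (e.le_symm_apply.2 hR1)
      (e.symm_apply_le.2 hR2) (e.le_symm_apply.2 hS1) (e.symm_apply_le.2 hS2)
    exact this.imp e.symm.le_iff_le.1 e.symm.le_iff_le.1

theorem intervalHeight_eq {p n : ℕ} (hp : 2 ≤ p) (e : GapSeq p n ≃o FibPath p n)
    {P Q : GapSeq p n} (h : P ≤ Q) :
    intervalHeight ⟨(e P, e Q), e.monotone h⟩ = ((gapHeight n P Q : ℕ) : WithBot ℕ∞) := by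
  rw [← GapSeq.krullDim_Icc hp h]
  apply le_antisymm
  · exact Order.krullDim_le_of_strictMono (β := Set.Icc P Q)
      (fun R : Set.Icc (e P) (e Q) =>
        ⟨e.symm R.1, e.le_symm_apply.2 R.2.1, e.symm_apply_le.2 R.2.2⟩)
      fun R S hRS => e.symm.strictMono hRS
  · exact Order.krullDim_le_of_strictMono (β := Set.Icc (e P) (e Q))
      (fun R : Set.Icc P Q => ⟨e R.1, e.monotone R.2.1, e.monotone R.2.2⟩)
      fun R S hRS => e.strictMono hRS

theorem linearIntervalCount_eq {p : ℕ} (hp : 2 ≤ p) (n k : ℕ) :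
    linearIntervalCount p n k = (LinearPairs p n k).ncard := by
  obtain ⟨e⟩ := nonempty_gapSeq_orderIso_fibPath p n
  rw [linearIntervalCount, ← Nat.card_coe_set_eq]
  symm
  have hmem : ∀ x : LinearPairs p n k,
      IsLinearInterval (⟨(e ⟨x.1.1, x.2.1.1⟩, e ⟨x.1.2, x.2.1.2.1⟩), e.monotone x.2.1.2.2⟩ :
        NonemptyInterval (FibPath p n)) ∧
      intervalHeight (⟨(e ⟨x.1.1, x.2.1.1⟩, e ⟨x.1.2, x.2.1.2.1⟩), e.monotone x.2.1.2.2⟩ :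
        NonemptyInterval (FibPath p n)) = (k : WithBot ℕ∞) := by
    rintro ⟨⟨P, Q⟩, ⟨hP, hQ, hPQ⟩, h1, h2⟩
    have hle : (⟨P, hP⟩ : GapSeq p n) ≤ ⟨Q, hQ⟩ := hPQ
    exact ⟨(isLinearInterval_iff (by omega) e hle).2 h1,
      (intervalHeight_eq hp e hle).trans (congrArg (fun j : ℕ => (j : WithBot ℕ∞)) h2)⟩
  refine Nat.card_eq_of_bijective (fun x => ⟨_, hmem x⟩) ⟨?_, ?_⟩
  · rintro ⟨⟨P, Q⟩, hx⟩ ⟨⟨P', Q'⟩, hx'⟩ h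
    simp only [Subtype.mk.injEq, NonemptyInterval.mk.injEq, Prod.mk.injEq,
      EmbeddingLike.apply_eq_iff_eq] at h
    exact Subtype.ext (Prod.ext h.1 h.2)
  · rintro ⟨⟨⟨A, B⟩, hAB⟩, h1, h2⟩
    obtain ⟨P, rfl⟩ := e.surjective A
    obtain ⟨Q, rfl⟩ := e.surjective B
    have hle : P ≤ Q := e.le_iff_le.1 hAB
    refine ⟨⟨(P.1, Q.1), ⟨P.2, Q.2, hle⟩, (isLinearInterval_iff (by omega) e hle).1 h1, ?_⟩, rfl⟩
    have := (intervalHeight_eq hp e hle).symm.trans h2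
    exact_mod_cast this

theorem card_fibPath (p n : ℕ) : Nat.card (FibPath p n) = gapSeqCount p 0 n := by
  obtain ⟨e⟩ := nonempty_gapSeq_orderIso_fibPath p n
  rw [gapSeqCount_zero_eq, ← Nat.card_coe_set_eq]
  exact Nat.card_congr e.symm.toEquiv

/-! ### Generating functions. -/

/-- The series in which the coefficient of `x^n y^k` is `f n k`. -/
noncomputable def ofCoeffs (f : ℕ → ℕ → ℚ) : BiSeries := fun m => f (m 0) (m 1)

theorem coeff_ofCoeffs (f : ℕ → ℕ → ℚ) (m : Fin 2 →₀ ℕ) :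
    coeff m (ofCoeffs f) = f (m 0) (m 1) := rfl

theorem ofCoeffs_add (f g : ℕ → ℕ → ℚ) :
    ofCoeffs (fun n k => f n k + g n k) = ofCoeffs f + ofCoeffs g := by
  ext m; simp [coeff_ofCoeffs]

theorem ofCoeffs_sum {ι : Type*} (s : Finset ι) (f : ι → ℕ → ℕ → ℚ) :
    ofCoeffs (fun n k => ∑ i ∈ s, f i n k) = ∑ i ∈ s, ofCoeffs (f i) := by
  ext m; simp [coeff_ofCoeffs, map_sum]

theorem monomial_mul_ofCoeffs (a b : ℕ) (f : ℕ → ℕ → ℚ) :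
    xVar ^ a * yVar ^ b * ofCoeffs f =
      ofCoeffs fun n k => if a ≤ n ∧ b ≤ k then f (n - a) (k - b) else 0 := by
  ext m
  rw [xVar, yVar, X_pow_eq, X_pow_eq, monomial_mul_monomial, coeff_monomial_mul, coeff_ofCoeffs]
  have : Finsupp.single 0 a + Finsupp.single 1 b ≤ m ↔ a ≤ m 0 ∧ b ≤ m 1 := by
    rw [Finsupp.le_def, Fin.forall_fin_two]; simp
  simp only [this, coeff_ofCoeffs]
  congr 1
  simp

theorem one_eq_ofCoeffs : (1 : BiSeries) = ofCoeffs fun n k => if n = 0 ∧ k = 0 then 1 else 0 := by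
  ext m
  rw [coeff_one, coeff_ofCoeffs]
  have : m = 0 ↔ m 0 = 0 ∧ m 1 = 0 := by
    rw [Finsupp.ext_iff, Fin.forall_fin_two]; simp
  simp only [this]

theorem sum_pow_mul_ofCoeffs (I : Finset ℕ) (f : ℕ → ℕ → ℚ) :
    (∑ v ∈ I, xVar ^ v) * ofCoeffs f =
      ofCoeffs fun n k => ∑ v ∈ I, if v ≤ n then f (n - v) k else 0 := by
  rw [Finset.sum_mul, ofCoeffs_sum]
  refine Finset.sum_congr rfl fun v _ => ?_
  simpa using monomial_mul_ofCoeffs v 0 f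

/-- The generating series of the gap sequences whose first term is at most `p - d`. -/
noncomputable def gapSeries (p d : ℕ) : BiSeries :=
  ofCoeffs fun n k => if k = 0 then (gapSeqCount p d n : ℚ) else 0

theorem fibPathSeries_eq (p : ℕ) : fibPathSeries p = gapSeries p 0 := by
  ext m
  change (if m 1 = 0 then (Nat.card (FibPath p (m 0)) : ℚ) else 0) = _
  rw [card_fibPath]; rfl

theorem gapSeries_eq {p d : ℕ} (hd : d ≤ p) :
    gapSeries p d = 1 + (∑ v ∈ Finset.Icc 1 (p - d), xVar ^ v) * gapSeries p 0 := by
  rw [gapSeries, gapSeries, sum_pow_mul_ofCoeffs, one_eq_ofCoeffs, ← ofCoeffs_add]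
  congr 1
  funext n k
  by_cases hk : k = 0
  · subst hk
    rcases Nat.eq_zero_or_pos n with rfl | hn
    · rw [gapSeqCount_at_zero hd, Finset.sum_eq_zero]
      · simp
      · intro v hv
        rw [Finset.mem_Icc] at hv
        rw [if_neg (by omega)]
    · rw [gapSeqCount_of_pos hn]
      simp [hn.ne']
  · simp [hk]

theorem constantCoeff_sum_pow (a b : ℕ) (ha : 1 ≤ a) :
    constantCoeff (∑ i ∈ Finset.Icc a b, xVar ^ i) = 0 := by
  rw [map_sum, Finset.sum_eq_zero]
  intro i hi
  rw [Finset.mem_Icc] at hi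
  simp [xVar, show i ≠ 0 by omega]

theorem constantCoeff_Gpoly (p : ℕ) : constantCoeff (Gpoly p) = 1 := by
  rw [Gpoly, map_sub, constantCoeff_sum_pow 1 p le_rfl]; simp

theorem fibPathSeries_mul_Gpoly (p : ℕ) : fibPathSeries p * Gpoly p = 1 := by
  have h := gapSeries_eq (Nat.zero_le p)
  rw [fibPathSeries_eq, Gpoly]
  rw [Nat.sub_zero] at h
  linear_combination h

theorem fibPathSeries_eq_inv (p : ℕ) : fibPathSeries p = (Gpoly p)⁻¹ :=
  (MvPowerSeries.eq_inv_iff_mul_eq_one (by simp [constantCoeff_Gpoly])).2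
    (fibPathSeries_mul_Gpoly p)

/-- The generating series of the linear intervals whose bounds have distinct first terms. -/
noncomputable def activeSeries (p : ℕ) : BiSeries :=
  ofCoeffs fun n k => ((ActivePairs p n k).ncard : ℚ)

theorem linearIntervalSeries_mul_Gpoly {p : ℕ} (hp : 2 ≤ p) :
    linearIntervalSeries p * Gpoly p = 1 + activeSeries p := by
  have hL : linearIntervalSeries p = ofCoeffs fun n k => ((LinearPairs p n k).ncard : ℚ) := by
    ext m
    change (linearIntervalCount p (m 0) (m 1) : ℚ) = _
    rw [linearIntervalCount_eq hp]; rfl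
  have h : linearIntervalSeries p = 1 + activeSeries p +
      (∑ v ∈ Finset.Icc 1 p, xVar ^ v) * linearIntervalSeries p := by
    rw [hL, sum_pow_mul_ofCoeffs, one_eq_ofCoeffs, activeSeries, ← ofCoeffs_add, ← ofCoeffs_add]
    congr 1
    funext n k
    rcases Nat.eq_zero_or_pos n with rfl | hn
    · rw [ncard_linearPairs_zero, activePairs_zero, Finset.sum_eq_zero]
      · simp
      · intro v hv
        rw [Finset.mem_Icc] at hv
        rw [if_neg (by omega)]
    · rw [ncard_linearPairs_of_pos hn]
      simp [hn.ne', add_comm]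
  rw [Gpoly]
  linear_combination h

/-- The generating series of `stairCount`. -/
noncomputable def stairSeries (p q : ℕ) : BiSeries :=
  ofCoeffs fun n k => (stairCount p q n k : ℚ)

/-- At height one the factor `(k - 1) * q` vanishes, so the left side does not involve `q`. -/
theorem unit_stairSeries_eq (p q : ℕ) :
    yVar * ((∑ j ∈ Finset.Icc 2 p, xVar ^ j) * gapSeries p 1) =
      ofCoeffs fun n k => if k = 1 then (stairCount p q n 1 : ℚ) else 0 := by
  rw [gapSeries, sum_pow_mul_ofCoeffs]
  have := monomial_mul_ofCoeffs 0 1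
  simp only [pow_zero, one_mul, pow_one, Nat.zero_le, true_and, Nat.sub_zero] at this
  rw [this]
  congr 1
  funext n k
  rcases k with _ | _ | k
  · simp
  · simp [stairCount]
  · simp

/-- Lengthening a staircase by one index raises the height by one and the semilength by `q`, so the
series is geometric with ratio `x^q y`. -/
theorem stairSeries_eq (p q : ℕ) :
    stairSeries p q = yVar * ((∑ j ∈ Finset.Icc 2 p, xVar ^ j) * gapSeries p 1) +
      xVar ^ q * yVar * stairSeries p q := by
  have := monomial_mul_ofCoeffs q 1
  rw [pow_one] at this
  rw [unit_stairSeries_eq p q, stairSeries, this, ← ofCoeffs_add]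
  congr 1
  funext n k
  rcases k with _ | _ | k
  · simp [stairCount]
  · simp [stairCount]
  · simp only [stairCount, Nat.add_sub_cancel, Nat.add_eq_zero_iff, one_ne_zero, and_false, if_false,
      Nat.add_eq_right, zero_add, Nat.le_add_left, and_true]
    by_cases hq : q ≤ n
    · rw [if_pos hq]
      refine congrArg Nat.cast (Finset.sum_congr rfl fun j _ => ?_)
      have e : j + (k + 1) * q = j + k * q + q := by ring
      rw [e]
      by_cases h : j + k * q + q ≤ n
      · rw [if_pos h, if_pos (by omega), show n - q - (j + k * q) = n - (j + k * q + q) by omega]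
      · rw [if_neg h, if_neg (by omega)]
    · rw [if_neg hq, Finset.sum_eq_zero, Nat.cast_zero]
      intro j _
      rw [if_neg]
      have e : j + (k + 1) * q = j + k * q + q := by ring
      omega

theorem one_sub_mul_sum_pow {a b : ℕ} (h : a ≤ b + 1) :
    (1 - xVar) * ∑ i ∈ Finset.Icc a b, xVar ^ i = xVar ^ a - xVar ^ (b + 1) := by
  have : Finset.Icc a b = Finset.Ico a (b + 1) := by ext i; simp
  rw [this, mul_comm]
  exact geom_sum_Ico_mul_neg xVar h

theorem activeSeries_add {p : ℕ} (hp : 3 ≤ p) :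
    activeSeries p + yVar * ((∑ j ∈ Finset.Icc 2 p, xVar ^ j) * gapSeries p 1) =
      (∑ i ∈ Finset.Icc 1 p, ∑ j ∈ Finset.Icc 1 p with i + 2 ≤ j,
        xVar ^ j * yVar ^ (j - i) * gapSeries p (j - i)) +
      stairSeries p p + stairSeries p 1 + (∑ v ∈ Finset.Icc 3 p, xVar ^ v) * yVar ^ 3 := by
  have h3 : (∑ v ∈ Finset.Icc 3 p, xVar ^ v) * yVar ^ 3 =
      ofCoeffs fun n k => if k = 3 ∧ 3 ≤ n ∧ n ≤ p then 1 else 0 := by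
    have := monomial_mul_ofCoeffs 0 3 fun n k => if n = 0 ∧ k = 0 then 1 else 0
    rw [← one_eq_ofCoeffs, pow_zero, one_mul, mul_one] at this
    rw [this, sum_pow_mul_ofCoeffs]
    congr 1
    funext n k
    by_cases h : k = 3 ∧ 3 ≤ n ∧ n ≤ p
    · rw [if_pos h, Finset.sum_eq_single_of_mem n (by rw [Finset.mem_Icc]; omega)]
      · simp [h.1]
      · intro v _ hv
        split_ifs <;> first | rfl | omega
    · rw [if_neg h]
      refine Finset.sum_eq_zero fun v hv => ?_
      rw [Finset.mem_Icc] at hv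
      split_ifs <;> first | rfl | omega
  have hV : (∑ i ∈ Finset.Icc 1 p, ∑ j ∈ Finset.Icc 1 p with i + 2 ≤ j,
        xVar ^ j * yVar ^ (j - i) * gapSeries p (j - i)) =
      ofCoeffs fun n k => ∑ i ∈ Finset.Icc 1 p, ∑ j ∈ Finset.Icc 1 p with i + 2 ≤ j,
        ((if j - i = k ∧ j ≤ n then gapSeqCount p k (n - j) else 0 : ℕ) : ℚ) := by
    rw [ofCoeffs_sum]
    refine Finset.sum_congr rfl fun i _ => ?_
    rw [ofCoeffs_sum]
    refine Finset.sum_congr rfl fun j _ => ?_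
    rw [gapSeries, monomial_mul_ofCoeffs]
    congr 1
    funext n k
    by_cases h : j - i = k ∧ j ≤ n
    · rw [if_pos h, if_pos (by omega), if_pos (by omega), h.1]
    · rw [if_neg h, Nat.cast_zero]
      split_ifs <;> first | rfl | omega
  rw [h3, hV, unit_stairSeries_eq p 1, activeSeries, stairSeries, stairSeries, ← ofCoeffs_add,
    ← ofCoeffs_add, ← ofCoeffs_add, ← ofCoeffs_add]
  congr 1
  funext n k
  have := congrArg (Nat.cast (R := ℚ)) (ncard_activePairs hp n k)
  push_cast at this ⊢
  exact this

theorem Vseries_eq (p : ℕ) : Vseries p = ∑ i ∈ Finset.Icc 1 p, ∑ j ∈ Finset.Icc 1 p with i + 2 ≤ j,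
    xVar ^ j * yVar ^ (j - i) * gapSeries p (j - i) := by
  refine Finset.sum_congr rfl fun i _ => Finset.sum_congr rfl fun j hj => ?_
  rw [Finset.mem_filter, Finset.mem_Icc] at hj
  rw [gapSeries_eq (by omega), ← fibPathSeries_eq_inv, fibPathSeries_eq]

theorem gapSeries_one_mul_Gpoly {p : ℕ} (hp : 1 ≤ p) : gapSeries p 1 * Gpoly p = 1 - xVar ^ p := by
  have h1 := gapSeries_eq hp
  have h2 := fibPathSeries_mul_Gpoly p
  have h3 : Gpoly p = 1 - (∑ v ∈ Finset.Icc 1 (p - 1), xVar ^ v) - xVar ^ p := by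
    obtain ⟨q, rfl⟩ := Nat.exists_eq_add_of_le' hp
    rw [Gpoly, Finset.sum_Icc_succ_top (by omega), Nat.add_sub_cancel]; ring
  rw [fibPathSeries_eq] at h2
  linear_combination Gpoly p * h1 + (∑ v ∈ Finset.Icc 1 (p - 1), xVar ^ v) * h2 + h3

/-- With `A` the height-one series, this is the identity `A / (1 - x^p y) + A / (1 - x y) - A = A (1
- x^{p+1} y^2) / ((1 - x y) (1 - x^p y))`, followed by the closed forms of the two factors of `A`.
-/
theorem Wseries_eq {p : ℕ} (hp : 1 ≤ p) : Wseries p = stairSeries p p + stairSeries p 1 -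
    yVar * ((∑ j ∈ Finset.Icc 2 p, xVar ^ j) * gapSeries p 1) := by
  symm
  rw [Wseries, MvPowerSeries.eq_mul_inv_iff_mul_eq]
  · have h1 := stairSeries_eq p p
    have h2 := stairSeries_eq p 1
    have h3 := gapSeries_one_mul_Gpoly hp
    have h4 := one_sub_mul_sum_pow (show 2 ≤ p + 1 by omega)
    rw [pow_one] at h2
    set S := ∑ j ∈ Finset.Icc 2 p, xVar ^ j
    have h5 : (stairSeries p p + stairSeries p 1 - yVar * (S * gapSeries p 1)) *
        ((1 - xVar * yVar) * (1 - xVar ^ p * yVar)) =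
        yVar * (S * gapSeries p 1) * (1 - xVar ^ (p + 1) * yVar ^ 2) := by
      linear_combination (1 - xVar * yVar) * h1 + (1 - xVar ^ p * yVar) * h2
    linear_combination (1 - xVar) * Gpoly p * h5 +
      yVar * (1 - xVar ^ (p + 1) * yVar ^ 2) * ((1 - xVar) * S * h3 + (1 - xVar ^ p) * h4)
  · simp [constantCoeff_Gpoly, xVar, yVar]

theorem mainTheorem7 (p : ℕ) (hp : 3 ≤ p) :
    fibPathSeries p = (Gpoly p)⁻¹ ∧
    linearIntervalSeries p =
      fibPathSeries p *
        (1 + xVar ^ 3 * yVar ^ 3 * (1 - xVar ^ (p - 2)) * (1 - xVar)⁻¹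
          + Vseries p + Wseries p) := by
  refine ⟨fibPathSeries_eq_inv p, ?_⟩
  have hE : (∑ v ∈ Finset.Icc 3 p, xVar ^ v) * yVar ^ 3 =
      xVar ^ 3 * yVar ^ 3 * (1 - xVar ^ (p - 2)) * (1 - xVar)⁻¹ := by
    rw [MvPowerSeries.eq_mul_inv_iff_mul_eq (by simp [xVar])]
    have h := one_sub_mul_sum_pow (show 3 ≤ p + 1 by omega)
    have e : (xVar : BiSeries) ^ (p + 1) = xVar ^ 3 * xVar ^ (p - 2) := by
      rw [← pow_add]; congr 1; omega
    rw [e] at h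
    linear_combination yVar ^ 3 * h
  rw [← hE, Vseries_eq, Wseries_eq (by omega)]
  have h1 := linearIntervalSeries_mul_Gpoly (show 2 ≤ p by omega)
  have h2 := fibPathSeries_mul_Gpoly p
  have h3 := activeSeries_add hp
  linear_combination fibPathSeries p * h1 - linearIntervalSeries p * h2 + fibPathSeries p * h3
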